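/- Let $\mathbb{R}^\infty=\bigcup_k\mathbb{R}^k$, $\mathbb{Z}^\infty=\bigcup_k\mathbb{Z}^k$, $\mathbb{Q}^\infty=\bigcup_k\mathbb{Q}^k$, and let $Q$ be an inner product on $\mathbb{R}^\infty$ with $Q(\mathbb{Z}^\infty\times\mathbb{Z}^\infty)\subset\mathbb{Q}$. A lattice cone is a pair $(C,\Lambda_C)$, where $C$ is a strongly convex cone (i.e. $C\cap(-C)=\{0\}$) generated by finitely many vectors of $\mathbb{Q}^\infty$ and $\Lambda_C\subset\mathbb{Q}^\infty$ is a finitely generated subgroup that spans the same linear subspace $\mathrm{lin}(C)$ of $\mathbb{R}^\infty$ as $C$. Let $\mathcal{C}$ be the set of lattice cones and $\mathbb{Q}\mathcal{C}$ the $\mathbb{Q}$-vector space with basis $\mathcal{C}$. Write $(C,\Lambda_C)\perp^Q(D,\Lambda_D)$ if $Q(u,v)=0$ for all $u\in\Lambda_C$, $v\in\Lambda_D$; for $x,y\in\mathbb{Q}\mathcal{C}$ write $x\perp^Q y$ if every basis element occurring in $x$ is orthogonal to every basis element occurring in $y$. On pairs $x\perp^Q y$ define the product $x\cdot y$ by bilinear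 extension of the Minkowski product $(C,\Lambda_C)\cdot(D,\Lambda_D)=(C+D,\Lambda_C+\Lambda_D)$ of orthogonal lattice cones; let the unit $1$ be $(\{0\},\{0\})$, and $u(k)=k\cdot 1$ for $k\in\mathbb{Q}$. Define linear maps $$\Delta(C,\Lambda_C)=\sum_{F}t\big((C,\Lambda_C),(F,\Lambda_F)\big)\otimes(F,\Lambda_F),\qquad \varepsilon(C,\Lambda_C)=\begin{cases}1,&(C,\Lambda_C)=(\{0\},\{0\}),\\0,&\text{otherwise,}\end{cases}$$ where $F$ runs over all faces of $C$ (including $\{0\}$ and $C$), $\Lambda_F=\Lambda_C\cap\mathrm{lin}(F)$, and $t((C,\Lambda_C),(F,\Lambda_F))$ is the image of $(C,\Lambda_C)$ under the $Q$-orthogonal projection to the orthogonal subspace of $\mathrm{lin}(F)$. Then $(\mathbb{Q}\mathcal{C},\perp^Q,\cdot,u,\Delta,\varepsilon)$ is a locality Hopf algebra. Explicitly, with $B=\mathbb{Q}\mathcal{C}$, $\top=\;\perp^Q$ and $U^\top=\{x\in B: v\top x\text{ for all }v\in U\}$ for $U\subseteq B$: 1. (Locality algebra) $\top$ is symmetric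 and every $U^\top$ is a linear subspace; the product is bilinear whenever all pairs involved are related, it is commutative, $x\cdot y\in U^\top$ for $x,y\in U^\top$ with $x\top y$, $(x\cdot y)\cdot z=x\cdot(y\cdot z)$ for pairwise related $x,y,z$, $\{1\}^\top=B$ and $x\cdot 1=1\cdot x=x$. 2. (Locality coalgebra) $\Delta$ is coassociative with counit $\varepsilon$, and for every $U\subseteq B$ one has $\Delta(U^\top)\subseteq U^\top\otimes_\top U^\top$, the span of all $a\otimes b$ with $a,b\in U^\top$ and $a\top b$. 3. (Compatibility) $\Delta:B\to B\otimes_\top B$ and $\varepsilon:B\to\mathbb{Q}$ are unital locality algebra homomorphisms: $\Delta(1)=1\otimes 1$, $\varepsilon(1)=1$, and if $x\top y$, then $\varepsilon(x\cdot y)=\varepsilon(x)\varepsilon(y)$, one can write $\Delta(x)=\sum_i a_i\otimes b_i$ and $\Delta(y)=\sum_j c_j\otimes d_j$ as finite sums such that $a_i\top b_i$ for all $i$, $c_j\top d_j$ for all $j$, and $a_i,b_i,c_j,d_j$ are pairwise related for all $i,j$, and $\Delta(x\cdot y)=\sum_{i,j}(a_i\cdot c_j)\otimes(b_i\cdot d_j)$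 for all such expressions. 4. (Antipode) There is a linear map $S:B\to B$ such that $S$ and $\mathrm{Id}$ are mutually independent, i.e. $x\top y$ implies $S(x)\top y$ and $x\top S(y)$, and $S\star\mathrm{Id}=\mathrm{Id}\star S=u\circ\varepsilon$, i.e. $\sum_i S(a_i)\cdot b_i=\sum_i a_i\cdot S(b_i)=\varepsilon(x)1$ whenever $\Delta(x)=\sum_i a_i\otimes b_i$ is a finite sum with $a_i\top b_i$ for all $i$. -/

import Mathlib

open scoped TensorProduct

namespace LocalityCone

noncomputable section

/-! ### Locality structures

A locality relation on `X` is a relation `top : X → X → Prop`, and a partial product defined exactly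
on related pairs is a function `mul : ∀ x y, top x y → X`. -/

/-- The polar subset of `U`: the elements that are related to all elements of `U`. -/
def polar {X : Type*} (top : X → X → Prop) (U : Set X) : Set X :=
  {x | ∀ u ∈ U, top u x}

/-- Locality semigroup: a symmetric relation with a product on related pairs that is compatible
with the relation and associative on pairwise related triples. In `assoc`, the proofs `h₁` and `h₂`
that the two outer products are defined always exist, by `mul_mem_polar`. -/
structure IsLocalitySemigroup {G : Type*} (top : G → G → Prop)
    (mul : ∀ x y : G, top x y → G) : Prop where
  symm : ∀ x y, top x y → top y x
  mul_mem_polar : ∀ (U : Set G) (x y : G) (h : top x y),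
    x ∈ polar top U → y ∈ polar top U → mul x y h ∈ polar top U
  assoc : ∀ (x y z : G) (hxy : top x y) (hyz : top y z) (_ : top x z)
    (h₁ : top (mul x y hxy) z) (h₂ : top x (mul y z hyz)),
    mul (mul x y hxy) z h₁ = mul x (mul y z hyz) h₂

/-- Locality monoid: a locality semigroup with a unit, which is related to every element. -/
structure IsLocalityMonoid {G : Type*} (top : G → G → Prop)
    (mul : ∀ x y : G, top x y → G) (one : G) : Prop
    extends IsLocalitySemigroup top mul where
  polar_one : polar top {one} = Set.univ
  mul_one : ∀ (x : G) (h : top x one), mul x one h = x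
  one_mul : ∀ (x : G) (h : top one x), mul one x h = x

/-- Locality vector space: the relation is symmetric, and polar subsets are linear subspaces. -/
structure IsLocalityVectorSpace (K : Type*) {V : Type*} [Field K] [AddCommGroup V] [Module K V]
    (top : V → V → Prop) : Prop where
  symm : ∀ x y, top x y → top y x
  polar_subspace : ∀ X : Set V, ∃ W : Submodule K V, (W : Set V) = polar top X

/-- Locality bilinearity of a map that is defined on related pairs: each identity holds whenever
all the pairs in it are related. -/
structure IsLocalityBilinear (K : Type*) {V U : Type*} [Field K] [AddCommGroup V] [Module K V]
    [AddCommGroup U] [Module K U] (top : V → V → Prop) (f : ∀ x y : V, top x y → U) : Prop where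
  add_left : ∀ (v₁ v₂ w : V) (h : top (v₁ + v₂) w) (h₁ : top v₁ w) (h₂ : top v₂ w),
    f (v₁ + v₂) w h = f v₁ w h₁ + f v₂ w h₂
  add_right : ∀ (v w₁ w₂ : V) (h : top v (w₁ + w₂)) (h₁ : top v w₁) (h₂ : top v w₂),
    f v (w₁ + w₂) h = f v w₁ h₁ + f v w₂ h₂
  smul_left : ∀ (k : K) (v w : V) (h : top (k • v) w) (h₁ : top v w),
    f (k • v) w h = k • f v w h₁
  smul_right : ∀ (k : K) (v w : V) (h : top v (k • w)) (h₁ : top v w),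
    f v (k • w) h = k • f v w h₁

/-- (Commutative, unitary) locality algebra over `K`. The unit map is `k ↦ k • one`. -/
structure IsLocalityAlgebra (K : Type*) {A : Type*} [Field K] [AddCommGroup A] [Module K A]
    (top : A → A → Prop) (mul : ∀ x y : A, top x y → A) (one : A) : Prop where
  vectorSpace : IsLocalityVectorSpace K top
  bilinear : IsLocalityBilinear K top mul
  monoid : IsLocalityMonoid top mul one
  comm : ∀ (x y : A) (h : top x y) (h' : top y x), mul x y h = mul y x h'

/-- The locality tensor product of two subsets `S`, `T` of `V`, inside `V ⊗ V`: the span of the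
pure tensors `a ⊗ b` with `a ∈ S`, `b ∈ T` and `a` related to `b`. -/
def locTensor (K : Type*) {V : Type*} [Field K] [AddCommGroup V] [Module K V]
    (top : V → V → Prop) (S T : Set V) : Submodule K (V ⊗[K] V) :=
  Submodule.span K {t | ∃ a ∈ S, ∃ b ∈ T, top a b ∧ t = a ⊗ₜ[K] b}

/-- Locality coalgebra: a coassociative counital coalgebra on a locality vector space whose
coproduct maps `Uᵀ` to `Uᵀ ⊗_⊤ Uᵀ` for every subset `U`. -/
structure IsLocalityCoalgebra (K : Type*) {C : Type*} [Field K] [AddCommGroup C] [Module K C]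
    (top : C → C → Prop) (Δ : C →ₗ[K] C ⊗[K] C) (ε : C →ₗ[K] K) : Prop where
  vectorSpace : IsLocalityVectorSpace K top
  comul_mem : ∀ (U : Set C), ∀ c ∈ polar top U,
    Δ c ∈ locTensor K top (polar top U) (polar top U)
  coassoc : ∀ c, TensorProduct.assoc K C C C ((Δ.rTensor C) (Δ c)) = (Δ.lTensor C) (Δ c)
  counit_left : ∀ c, TensorProduct.lid K C ((ε.rTensor C) (Δ c)) = c
  counit_right : ∀ c, TensorProduct.rid K C ((ε.lTensor C) (Δ c)) = c

/-- For families `a i ⊗ b i` and `c j ⊗ d j` of pure tensors: each quadruple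
`(a i, b i, c j, d j)` consists of pairwise related elements (and the pairs `(a i, b i)` and
`(c j, d j)` are related even if the other family is empty). -/
def IndepTensors {B : Type*} (top : B → B → Prop) {m n : ℕ} (a b : Fin m → B)
    (c d : Fin n → B) : Prop :=
  (∀ i, top (a i) (b i)) ∧ (∀ j, top (c j) (d j)) ∧
    ∀ i j, top (a i) (c j) ∧ top (a i) (d j) ∧ top (b i) (c j) ∧ top (b i) (d j)

/-- The locality relation on `B ⊗_⊤ B`: two tensors are related if they can be written as sums of
pure tensors `a i ⊗ b i` and `c j ⊗ d j` with all `(a i, b i, c j, d j)` pairwise related. -/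
def tensorTop (K : Type*) {B : Type*} [Field K] [AddCommGroup B] [Module K B]
    (top : B → B → Prop) (s t : B ⊗[K] B) : Prop :=
  ∃ (m n : ℕ) (a b : Fin m → B) (c d : Fin n → B), IndepTensors top a b c d ∧
    s = ∑ i, a i ⊗ₜ[K] b i ∧ t = ∑ j, c j ⊗ₜ[K] d j

/-- Locality bialgebra: a locality algebra and locality coalgebra such that `Δ : B → B ⊗_⊤ B` and
`ε : B → K` are (unital) locality algebra homomorphisms. The product of `∑ a i ⊗ b i` and
`∑ c j ⊗ d j` is `∑ (a i * c j) ⊗ (b i * d j)`; `comul_mul` asks for the multiplicativity of `Δ`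
with every admissible way of writing the coproducts as sums of pure tensors (and `comul_top`
provides at least one). The ground field carries the full locality relation, so there is no
locality condition on `ε`. -/
structure IsLocalityBialgebra (K : Type*) {B : Type*} [Field K] [AddCommGroup B] [Module K B]
    (top : B → B → Prop) (mul : ∀ x y : B, top x y → B) (one : B)
    (Δ : B →ₗ[K] B ⊗[K] B) (ε : B →ₗ[K] K) : Prop where
  algebra : IsLocalityAlgebra K top mul one
  coalgebra : IsLocalityCoalgebra K top Δ ε
  comul_top : ∀ x y, top x y → tensorTop K top (Δ x) (Δ y)
  comul_mul : ∀ (x y : B) (h : top x y) (m n : ℕ) (a b : Fin m → B) (c d : Fin n → B)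
    (H : IndepTensors top a b c d),
    Δ x = ∑ i, a i ⊗ₜ[K] b i → Δ y = ∑ j, c j ⊗ₜ[K] d j →
    Δ (mul x y h) = ∑ i, ∑ j,
      mul (a i) (c j) (H.2.2 i j).1 ⊗ₜ[K] mul (b i) (d j) (H.2.2 i j).2.2.2
  comul_one : Δ one = one ⊗ₜ[K] one
  counit_mul : ∀ (x y : B) (h : top x y), ε (mul x y h) = ε x * ε y
  counit_one : ε one = 1

/-- Two maps are independent if they send related pairs to related pairs. -/
def Independent {X Y : Type*} (topX : X → X → Prop) (topY : Y → Y → Prop) (φ ψ : X → Y) : Prop :=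
  ∀ x y, topX x y → topY (φ x) (ψ y)

/-- `φ ⋆ ψ = χ` for the convolution product `m ∘ (φ ⊗ ψ) ∘ Δ` of two independent maps, where the
coproduct of `x` may be written in any way as a sum of pure tensors `a i ⊗ b i` with `a i` related
to `b i` (there is at least one such way in a locality coalgebra). -/
def IsConvolution (K : Type*) {B : Type*} [Field K] [AddCommGroup B] [Module K B]
    (top : B → B → Prop) (mul : ∀ x y : B, top x y → B) (Δ : B →ₗ[K] B ⊗[K] B)
    (φ ψ : B →ₗ[K] B) (h : Independent top top φ ψ) (χ : B →ₗ[K] B) : Prop :=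
  ∀ (x : B) (n : ℕ) (a b : Fin n → B) (H : ∀ i, top (a i) (b i)),
    Δ x = ∑ i, a i ⊗ₜ[K] b i →
    ∑ i, mul (φ (a i)) (ψ (b i)) (h (a i) (b i) (H i)) = χ x

/-- Antipode: a linear map `S` such that `S` and `Id` are mutually independent and
`S ⋆ Id = Id ⋆ S = u ∘ ε`. -/
def IsAntipode (K : Type*) {B : Type*} [Field K] [AddCommGroup B] [Module K B]
    (top : B → B → Prop) (mul : ∀ x y : B, top x y → B) (one : B)
    (Δ : B →ₗ[K] B ⊗[K] B) (ε : B →ₗ[K] K) (S : B →ₗ[K] B) : Prop :=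
  ∃ (h : Independent top top S (LinearMap.id : B →ₗ[K] B))
    (h' : Independent top top (LinearMap.id : B →ₗ[K] B) S),
    IsConvolution K top mul Δ S LinearMap.id h (ε.smulRight one) ∧
    IsConvolution K top mul Δ LinearMap.id S h' (ε.smulRight one)

/-- Locality Hopf algebra: a locality bialgebra with an antipode. -/
structure IsLocalityHopfAlgebra (K : Type*) {B : Type*} [Field K] [AddCommGroup B] [Module K B]
    (top : B → B → Prop) (mul : ∀ x y : B, top x y → B) (one : B)
    (Δ : B →ₗ[K] B ⊗[K] B) (ε : B →ₗ[K] K) : Prop where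
  bialgebra : IsLocalityBialgebra K top mul one Δ ε
  exists_antipode : ∃ S : B →ₗ[K] B, IsAntipode K top mul one Δ ε S

/-- The linear extension of a relation on `X` to the vector space `K X` spanned by `X`: all basis
elements occurring in `x` are related to all basis elements occurring in `y`. -/
def freeTop {K X : Type*} [Field K] (top : X → X → Prop) (x y : X →₀ K) : Prop :=
  ∀ c ∈ x.support, ∀ d ∈ y.support, top c d

/-! ### The filtered rational Euclidean lattice space -/

/-- `ℝ^∞ = ⋃ ℝ^k`: the real sequences with finite support. -/
abbrev RInf : Type := ℕ →₀ ℝ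

/-- The vectors of `ℚ^∞ = ⋃ ℚ^k`. -/
def IsRational (v : RInf) : Prop := ∀ i, ∃ q : ℚ, v i = (q : ℝ)

/-- An inner product on `ℝ^∞` (that is, a compatible family of inner products on the `ℝ^k`) that
takes rational values on `ℤ^∞` (equivalently, on pairs of standard basis vectors). -/
structure RatInnerProduct where
  form : LinearMap.BilinForm ℝ RInf
  symm : ∀ x y, form x y = form y x
  pos : ∀ x, x ≠ 0 → 0 < form x x
  rational : ∀ i j : ℕ, ∃ q : ℚ, form (Finsupp.single i 1) (Finsupp.single j 1) = (q : ℝ)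

/-- A (strongly convex) lattice cone in `ℝ^∞`: a strongly convex cone generated by finitely many
rational vectors, together with a lattice of rational vectors in its linear span. -/
@[ext]
structure LatticeCone where
  cone : PointedCone ℝ RInf
  lattice : Submodule ℤ RInf
  polyhedral : ∃ s : Finset RInf, (∀ u ∈ s, IsRational u) ∧ cone = PointedCone.hull ℝ s
  salient : ∀ x ∈ cone, -x ∈ cone → x = 0
  lattice_rational : ∀ u ∈ lattice, IsRational u
  lattice_fg : lattice.FG
  span_lattice : Submodule.span ℝ (lattice : Set RInf) = Submodule.span ℝ (cone : Set RInf)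

/-! ### Rationality lemmas -/

lemma IsRational.zero : IsRational 0 := fun i => ⟨0, by simp⟩

lemma IsRational.add {u v : RInf} (hu : IsRational u) (hv : IsRational v) :
    IsRational (u + v) := fun i => by
  obtain ⟨a, ha⟩ := hu i
  obtain ⟨b, hb⟩ := hv i
  exact ⟨a + b, by simp [ha, hb]⟩

lemma IsRational.smul {u : RInf} (q : ℚ) (hu : IsRational u) :
    IsRational ((q : ℝ) • u) := fun i => by
  obtain ⟨a, ha⟩ := hu i
  exact ⟨q * a, by simp [ha]⟩

lemma IsRational.sub {u v : RInf} (hu : IsRational u) (hv : IsRational v) :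
    IsRational (u - v) := by
  have h := hu.add (hv.smul (-1))
  simpa [sub_eq_add_neg] using h

lemma RatInnerProduct.rational_form (Q : RatInnerProduct) {u v : RInf} (hu : IsRational u)
    (hv : IsRational v) : ∃ q : ℚ, Q.form u v = (q : ℝ) := by
  choose a ha using hu
  choose b hb using hv
  choose g hg using Q.rational
  refine ⟨∑ i ∈ u.support, ∑ j ∈ v.support, a i * b j * g i j, ?_⟩
  have hu' : u = ∑ i ∈ u.support, u i • Finsupp.single i (1 : ℝ) := by
    conv_lhs => rw [← Finsupp.sum_single u]
    simp [Finsupp.sum]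
  have hv' : v = ∑ i ∈ v.support, v i • Finsupp.single i (1 : ℝ) := by
    conv_lhs => rw [← Finsupp.sum_single v]
    simp [Finsupp.sum]
  conv_lhs => rw [hu', hv']
  push_cast
  simp only [map_sum, LinearMap.sum_apply, map_smul, LinearMap.smul_apply, smul_eq_mul, hg, ha, hb]
  simp only [Finset.mul_sum]
  rw [Finset.sum_comm]
  refine Finset.sum_congr rfl fun i _ => Finset.sum_congr rfl fun j _ => ?_
  ring

/-- A rational vector in the real span of a group `Λ` of rational vectors has a nonzero integer
multiple in `Λ`. -/
lemma exists_smul_mem_of_mem_span (Λ : Submodule ℤ RInf) (hΛ : ∀ u ∈ Λ, IsRational u)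
    {u : RInf} (hu : IsRational u) (h : u ∈ Submodule.span ℝ (Λ : Set RInf)) :
    ∃ n : ℤ, n ≠ 0 ∧ n • u ∈ Λ := by
  have hinj : LinearMap.ker (Algebra.linearMap ℚ ℝ) = ⊥ :=
    LinearMap.ker_eq_bot.2 (algebraMap ℚ ℝ).injective
  obtain ⟨r, hr⟩ := LinearMap.exists_leftInverse_of_injective (Algebra.linearMap ℚ ℝ) hinj
  have hr' : ∀ q : ℚ, r (q : ℝ) = q := fun q => by
    simpa using congrArg (fun f => f q) hr
  let ρ : RInf →ₗ[ℚ] RInf := Finsupp.mapRange.linearMap ((Algebra.linearMap ℚ ℝ) ∘ₗ r)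
  have hρ : ∀ (c : ℝ) (x : RInf), IsRational x → ρ (c • x) = (r c) • x := by
    intro c x hx
    ext i
    obtain ⟨q, hq⟩ := hx i
    have h1 : c * (q : ℝ) = q • c := by rw [Rat.smul_def, mul_comm]
    simp only [ρ, Finsupp.mapRange.linearMap_apply, Finsupp.mapRange_apply, Finsupp.smul_apply,
      hq, smul_eq_mul, h1, LinearMap.comp_apply, map_smul, Algebra.linearMap_apply]
    simp [Rat.smul_def, mul_comm]
  have key : ∀ x ∈ Submodule.span ℝ (Λ : Set RInf), ∀ c : ℝ,
      ρ (c • x) ∈ Submodule.span ℚ (Λ : Set RInf) := by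
    intro x hx
    induction hx using Submodule.span_induction with
    | mem x hx =>
      intro c
      rw [hρ c x (hΛ x hx)]
      exact Submodule.smul_mem _ _ (Submodule.subset_span hx)
    | zero => intro c; simp
    | add x y _ _ hx hy =>
      intro c
      rw [smul_add, map_add]
      exact Submodule.add_mem _ (hx c) (hy c)
    | smul a x _ hx =>
      intro c
      rw [smul_smul]
      exact hx _
  have hu' : u ∈ Submodule.span ℚ (Λ : Set RInf) := by
    have h1 := key u h 1
    have h2 : r 1 = 1 := by simpa using hr' 1
    rwa [hρ 1 u hu, h2, one_smul] at h1
  clear h hu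
  induction hu' using Submodule.span_induction with
  | mem x hx => exact ⟨1, one_ne_zero, by simpa using hx⟩
  | zero => exact ⟨1, one_ne_zero, by simp⟩
  | add x y _ _ hx hy =>
    obtain ⟨m, hm, hm'⟩ := hx
    obtain ⟨n, hn, hn'⟩ := hy
    refine ⟨m * n, mul_ne_zero hm hn, ?_⟩
    rw [smul_add]
    refine Λ.add_mem ?_ ?_
    · rw [mul_comm, mul_smul]; exact Λ.smul_mem _ hm'
    · rw [mul_smul]; exact Λ.smul_mem _ hn'
  | smul q x _ hx =>
    obtain ⟨m, hm, hm'⟩ := hx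
    refine ⟨q.den * m, mul_ne_zero (by exact_mod_cast q.den_ne_zero) hm, ?_⟩
    have : ((q.den : ℤ) * m) • (q • x) = q.num • (m • x) := by
      rw [← Int.cast_smul_eq_zsmul ℚ, ← Int.cast_smul_eq_zsmul ℚ, ← Int.cast_smul_eq_zsmul ℚ,
        smul_smul, smul_smul]
      congr 1
      push_cast
      have := Rat.den_mul_eq_num q
      calc (q.den : ℚ) * m * q = ((q.den : ℚ) * q) * m := by ring
        _ = _ := by rw [this]
    rw [this]
    exact Λ.smul_mem _ hm'

/-! ### Orthogonal projections -/

/-- Gram-Schmidt: orthogonal projections to finitely generated subspaces exist, and are rational for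
rational data. -/
lemma RatInnerProduct.exists_orth (Q : RatInnerProduct) (s : Finset RInf) :
    ∀ u, ∃ w ∈ Submodule.span ℝ (s : Set RInf), (∀ f ∈ s, Q.form f (u - w) = 0) ∧
      ((∀ f ∈ s, IsRational f) → IsRational u → IsRational w) := by
  classical
  induction s using Finset.induction_on with
  | empty => exact fun u => ⟨0, Submodule.zero_mem _, by simp, fun _ _ => IsRational.zero⟩
  | insert f s _ ih =>
    intro u
    obtain ⟨w, hw, hw0, hwr⟩ := ih u
    obtain ⟨v, hv, hv0, hvr⟩ := ih f
    have hle : Submodule.span ℝ (s : Set RInf) ≤ Submodule.span ℝ ((insert f s : Finset _) : Set _) :=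
      Submodule.span_mono (by simp)
    have hfmem : f ∈ Submodule.span ℝ ((insert f s : Finset RInf) : Set RInf) :=
      Submodule.subset_span (by simp)
    have hspan : ∀ x, (∀ g ∈ s, Q.form g x = 0) → ∀ y ∈ Submodule.span ℝ (s : Set RInf),
        Q.form y x = 0 := by
      intro x hx y hy
      induction hy using Submodule.span_induction with
      | mem y hy => exact hx y hy
      | zero => simp
      | add a b _ _ ha hb => simp [ha, hb]
      | smul c a _ ha => simp [ha]
    by_cases hf : f - v = 0
    · refine ⟨w, hle hw, ?_, fun h hu => hwr (fun g hg => h g (Finset.mem_insert_of_mem hg)) hu⟩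
      intro g hg
      rcases Finset.mem_insert.1 hg with rfl | hg
      · rw [sub_eq_zero.1 hf]; exact hspan _ hw0 _ hv
      · exact hw0 g hg
    · have hpos := Q.pos _ hf
      refine ⟨w + (Q.form (f - v) (u - w) / Q.form (f - v) (f - v)) • (f - v), ?_, ?_, ?_⟩
      · exact Submodule.add_mem _ (hle hw)
          (Submodule.smul_mem _ _ (Submodule.sub_mem _ hfmem (hle hv)))
      · have hs : ∀ g ∈ s, Q.form g (u - (w + (Q.form (f - v) (u - w) /
            Q.form (f - v) (f - v)) • (f - v))) = 0 := by
          intro g hg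
          rw [← sub_sub, map_sub, hw0 g hg, map_smul, hv0 g hg]; simp
        intro g hg
        rcases Finset.mem_insert.1 hg with rfl | hg
        · have h1 := hspan _ hs _ hv
          have h2 : Q.form (g - v) (u - (w + (Q.form (g - v) (u - w) /
            Q.form (g - v) (g - v)) • (g - v))) = 0 := by
            rw [← sub_sub, map_sub _ (u - w), map_smul, smul_eq_mul, div_mul_cancel₀ _ hpos.ne',
              sub_self]
          generalize u - (w + (Q.form (g - v) (u - w) /
            Q.form (g - v) (g - v)) • (g - v)) = z at h1 h2 ⊢
          rwa [map_sub Q.form, LinearMap.sub_apply, h1, sub_zero] at h2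
        · exact hs g hg
      · intro h hu
        have hfr : IsRational (f - v) := (h f (Finset.mem_insert_self _ _)).sub
          (hvr (fun g hg => h g (Finset.mem_insert_of_mem hg)) (h f (Finset.mem_insert_self _ _)))
        have hwr' := hwr (fun g hg => h g (Finset.mem_insert_of_mem hg)) hu
        obtain ⟨p, hp⟩ := Q.rational_form hfr (hu.sub hwr')
        obtain ⟨q, hq⟩ := Q.rational_form hfr hfr
        rw [hp, hq, ← Rat.cast_div]
        exact hwr'.add (hfr.smul _)

lemma RatInnerProduct.orthogonal_span (Q : RatInnerProduct) (s : Set RInf) (x : RInf)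
    (hx : ∀ f ∈ s, Q.form f x = 0) : x ∈ Q.form.orthogonal (Submodule.span ℝ s) := by
  intro y hy
  induction hy using Submodule.span_induction with
  | mem y hy => exact hx y hy
  | zero => simp
  | add a b _ _ ha hb => simp [ha, hb]
  | smul c a _ ha => simp [ha]

lemma RatInnerProduct.isCompl (Q : RatInnerProduct) (W : Submodule ℝ RInf)
    [FiniteDimensional ℝ W] : IsCompl (Q.form.orthogonal W) W := by
  constructor
  · rw [Submodule.disjoint_def]
    intro x hx hxW
    by_contra hne
    exact (Q.pos x hne).ne' (hx x hxW)
  · rw [codisjoint_iff, Submodule.eq_top_iff']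
    intro u
    obtain ⟨s, rfl⟩ := (Submodule.fg_iff_finiteDimensional W).2 inferInstance
    obtain ⟨w, hw, hw0, -⟩ := Q.exists_orth s u
    rw [← sub_add_cancel u w]
    exact Submodule.add_mem_sup (Q.orthogonal_span _ _ hw0) hw

/-- The `Q`-orthogonal projection of `ℝ^∞` to the orthogonal subspace of `W`. -/
def RatInnerProduct.proj (Q : RatInnerProduct) (W : Submodule ℝ RInf)
    [FiniteDimensional ℝ W] : RInf →ₗ[ℝ] RInf :=
  (Q.form.orthogonal W).projection W (Q.isCompl W)

lemma RatInnerProduct.proj_eq_zero_iff (Q : RatInnerProduct) (W : Submodule ℝ RInf)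
    [FiniteDimensional ℝ W] (x : RInf) : Q.proj W x = 0 ↔ x ∈ W :=
  Submodule.projection_apply_eq_zero_iff _

lemma RatInnerProduct.proj_rational (Q : RatInnerProduct) (s : Finset RInf)
    (hs : ∀ f ∈ s, IsRational f) (W : Submodule ℝ RInf) [FiniteDimensional ℝ W]
    (hW : W = Submodule.span ℝ (s : Set RInf)) {u : RInf} (hu : IsRational u) :
    IsRational (Q.proj W u) := by
  subst hW
  obtain ⟨w, hw, hw0, hwr⟩ := Q.exists_orth s u
  have h1 : Q.proj (Submodule.span ℝ (s : Set RInf)) u = u - w := by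
    conv_lhs => rw [← sub_add_cancel u w, map_add, (Q.proj_eq_zero_iff _ w).2 hw, add_zero]
    exact Submodule.projection_apply_of_mem_left _ (Q.orthogonal_span _ _ hw0)
  rw [h1]
  exact hu.sub (hwr hs hu)

/-! ### Lattice cones: unit, orthogonality, product, faces, transverse cones -/

namespace LatticeCone

/-- The linear subspace spanned by (the cone of) a lattice cone. -/
def linSpan (C : LatticeCone) : Submodule ℝ RInf := Submodule.span ℝ (C.cone : Set RInf)

/-- The trivial lattice cone `({0}, {0})`. -/
def unit : LatticeCone where
  cone := ⊥
  lattice := ⊥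
  polyhedral := ⟨∅, by simp, by simp⟩
  salient := fun x hx _ => by simpa using hx
  lattice_rational := fun u hu => by
    rw [(Submodule.mem_bot ℤ).1 hu]; exact IsRational.zero
  lattice_fg := Submodule.fg_bot
  span_lattice := by simp

/-- Two lattice cones are orthogonal if their lattices are. -/
def Orth (Q : RatInnerProduct) (C D : LatticeCone) : Prop :=
  ∀ u ∈ C.lattice, ∀ v ∈ D.lattice, Q.form u v = 0

lemma Orth.span {Q : RatInnerProduct} {C D : LatticeCone} (h : Orth Q C D) {x y : RInf}
    (hx : x ∈ C.linSpan) (hy : y ∈ D.linSpan) : Q.form x y = 0 := by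
  rw [linSpan, ← C.span_lattice] at hx
  rw [linSpan, ← D.span_lattice] at hy
  refine Q.orthogonal_span _ y (fun f hf => ?_) x hx
  rw [Q.symm]
  exact Q.orthogonal_span _ f (fun g hg => by rw [Q.symm]; exact h f hf g hg) y hy

/-- The Minkowski product `(C + D, Λ_C + Λ_D)` of orthogonal lattice cones. -/
def mul (Q : RatInnerProduct) (C D : LatticeCone) (h : Orth Q C D) : LatticeCone where
  cone := C.cone ⊔ D.cone
  lattice := C.lattice ⊔ D.lattice
  polyhedral := by
    classical
    obtain ⟨s, hs, hs'⟩ := C.polyhedral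
    obtain ⟨t, ht, ht'⟩ := D.polyhedral
    refine ⟨s ∪ t, fun u hu => ?_, ?_⟩
    · rcases Finset.mem_union.1 hu with hu | hu
      exacts [hs u hu, ht u hu]
    · rw [hs', ht', Finset.coe_union]
      exact (Submodule.span_union _ _).symm
  salient := by
    intro x hx hx'
    obtain ⟨c, hc, d, hd, rfl⟩ := Submodule.mem_sup.1 hx
    obtain ⟨c', hc', d', hd', he⟩ := Submodule.mem_sup.1 hx'
    have h1 : c + c' = -(d + d') := by
      rw [eq_neg_iff_add_eq_zero, ← add_neg_cancel (c + d), ← he]; abel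
    have hC : c + c' ∈ C.linSpan := Submodule.subset_span (C.cone.add_mem hc hc')
    have hD : c + c' ∈ D.linSpan := by
      rw [h1]
      exact Submodule.neg_mem _ (Submodule.subset_span (D.cone.add_mem hd hd'))
    have h0 : c + c' = 0 := by
      by_contra hne
      exact (Q.pos _ hne).ne' (h.span hC hD)
    have h0' : d + d' = 0 := by rw [h0, eq_comm, neg_eq_zero] at h1; exact h1
    rw [C.salient c hc (by rwa [neg_eq_of_add_eq_zero_right h0]),
      D.salient d hd (by rwa [neg_eq_of_add_eq_zero_right h0']), add_zero]
  lattice_rational := by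
    intro u hu
    obtain ⟨a, ha, b, hb, rfl⟩ := Submodule.mem_sup.1 hu
    exact (C.lattice_rational a ha).add (D.lattice_rational b hb)
  lattice_fg := C.lattice_fg.sup D.lattice_fg
  span_lattice := by
    have key : ∀ {R : Type} [Semiring R] [Module R RInf] [Module R ℝ] [IsScalarTower R ℝ RInf]
        (A B : Submodule R RInf), Submodule.span ℝ ((A ⊔ B : Submodule R RInf) : Set RInf) =
        Submodule.span ℝ (A : Set RInf) ⊔ Submodule.span ℝ (B : Set RInf) := by
      intro R _ _ _ _ A B
      refine le_antisymm (Submodule.span_le.2 fun x hx => ?_)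
        (sup_le (Submodule.span_mono fun x hx => Submodule.mem_sup_left hx)
          (Submodule.span_mono fun x hx => Submodule.mem_sup_right hx))
      obtain ⟨a, ha, b, hb, rfl⟩ := Submodule.mem_sup.1 hx
      exact Submodule.add_mem_sup (Submodule.subset_span ha) (Submodule.subset_span hb)
    rw [key, key, C.span_lattice, D.span_lattice]

/-- The faces of (the cone of) a lattice cone. -/
def Face (C : LatticeCone) : Type := {F : PointedCone ℝ RInf // F.IsFaceOf C.cone}

/-- A face is generated by the generators of the cone that it contains. -/
lemma face_eq_hull (C : LatticeCone) (s : Finset RInf) (hs : C.cone = PointedCone.hull ℝ s)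
    (F : C.Face) : F.1 = PointedCone.hull ℝ {u | u ∈ s ∧ u ∈ F.1} := by
  classical
  refine le_antisymm (fun x hx => ?_) (Submodule.span_le.2 fun u hu => hu.2)
  have hxC : x ∈ PointedCone.hull ℝ (s : Set RInf) := hs ▸ F.2.le hx
  obtain ⟨f, -, rfl⟩ := Submodule.mem_span_finset.1 hxC
  refine Submodule.sum_mem _ fun u hu => ?_
  have hsC : ∀ v ∈ s, v ∈ C.cone := fun v hv => hs ▸ PointedCone.subset_hull hv
  rcases eq_or_ne (f u) 0 with h0 | h0
  · rw [h0, zero_smul]; exact Submodule.zero_mem _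
  · refine Submodule.smul_mem _ _ (Submodule.subset_span ⟨hu, ?_⟩)
    rw [← Finset.add_sum_erase s _ hu] at hx
    exact F.2.mem_of_smul_add_mem (hsC u hu) (Submodule.sum_mem _ fun v hv =>
      PointedCone.smul_mem _ (f v).2 (hsC v (Finset.mem_of_mem_erase hv)))
      (a := (f u : ℝ)) (lt_of_le_of_ne (f u).2 fun h => h0 (Subtype.ext h.symm)) hx

instance (C : LatticeCone) : Finite C.Face := by
  classical
  obtain ⟨s, -, hs⟩ := C.polyhedral
  refine Finite.of_injective (fun F : C.Face => (⟨s.filter (· ∈ F.1), by simp⟩ : s.powerset)) ?_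
  intro F G h
  have h' : s.filter (· ∈ F.1) = s.filter (· ∈ G.1) := congrArg Subtype.val h
  refine Subtype.ext ?_
  rw [C.face_eq_hull s hs F, C.face_eq_hull s hs G]
  congr 1
  ext u
  simpa using Finset.ext_iff.1 h' u

instance (C : LatticeCone) : Fintype C.Face := Fintype.ofFinite _

/-- A face `F` of a lattice cone `(C, Λ_C)`, as the lattice cone `(F, Λ_C ∩ lin F)`. -/
def face (C : LatticeCone) (F : C.Face) : LatticeCone where
  cone := F.1
  lattice := C.lattice ⊓ (Submodule.span ℝ (F.1 : Set RInf)).restrictScalars ℤ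
  polyhedral := by
    classical
    obtain ⟨s, hs, hs'⟩ := C.polyhedral
    refine ⟨s.filter (· ∈ F.1), fun u hu => hs u (Finset.mem_filter.1 hu).1, ?_⟩
    conv_lhs => rw [C.face_eq_hull s hs' F]
    congr 1
    ext u
    simp
  salient := fun x hx hx' => C.salient x (F.2.le hx) (F.2.le hx')
  lattice_rational := fun u hu => C.lattice_rational u hu.1
  lattice_fg := by
    have : IsNoetherian ℤ C.lattice := isNoetherian_of_fg_of_noetherian _ C.lattice_fg
    exact Submodule.FG.of_le C.lattice_fg inf_le_left
  span_lattice := by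
    refine le_antisymm (Submodule.span_le.2 fun x hx => hx.2) ?_
    obtain ⟨s, hs, hs'⟩ := C.polyhedral
    have h1 : (F.1 : Set RInf) ⊆ Submodule.span ℝ {u | u ∈ s ∧ u ∈ F.1} := by
      intro x hx
      have hx' : x ∈ F.1 := hx
      rw [C.face_eq_hull s hs' F] at hx'
      exact PointedCone.hull_le_span ℝ _ hx'
    refine (Submodule.span_le.2 h1).trans (Submodule.span_le.2 ?_)
    rintro u ⟨hus, huF⟩
    have huC : u ∈ Submodule.span ℝ (C.lattice : Set RInf) := by
      rw [C.span_lattice]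
      exact Submodule.subset_span (F.2.le huF)
    obtain ⟨n, hn, hnu⟩ := exists_smul_mem_of_mem_span C.lattice C.lattice_rational (hs u hus) huC
    have h2 : n • u ∈ C.lattice ⊓ (Submodule.span ℝ (F.1 : Set RInf)).restrictScalars ℤ :=
      ⟨hnu, Submodule.smul_mem _ n (Submodule.subset_span huF)⟩
    have h3 : u = (n : ℝ)⁻¹ • (n • u) := by
      rw [← Int.cast_smul_eq_zsmul ℝ, smul_smul, inv_mul_cancel₀ (by exact_mod_cast hn), one_smul]
    rw [h3]
    exact Submodule.smul_mem _ _ (Submodule.subset_span h2)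

lemma linSpan_eq (C : LatticeCone) (s : Finset RInf) (hs : C.cone = PointedCone.hull ℝ s) :
    C.linSpan = Submodule.span ℝ (s : Set RInf) := by
  refine le_antisymm (Submodule.span_le.2 fun x hx => ?_) (Submodule.span_mono ?_)
  · have hx' : x ∈ C.cone := hx
    rw [hs] at hx'
    exact PointedCone.hull_le_span ℝ _ hx'
  · rw [hs]
    exact PointedCone.subset_hull

instance (C : LatticeCone) : FiniteDimensional ℝ C.linSpan := by
  obtain ⟨s, -, hs⟩ := C.polyhedral
  rw [C.linSpan_eq s hs]
  exact FiniteDimensional.span_finset ℝ s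

/-- The transverse cone `t((C, Λ_C), (F, Λ_F))`: the orthogonal projection of `(C, Λ_C)` to the
orthogonal subspace of the linear span of `F`. -/
def transverse (Q : RatInnerProduct) (C : LatticeCone) (F : C.Face) : LatticeCone where
  cone := C.cone.map (Q.proj (C.face F).linSpan)
  lattice := C.lattice.map ((Q.proj (C.face F).linSpan).restrictScalars ℤ)
  polyhedral := by
    classical
    obtain ⟨s, hs, hs'⟩ := C.polyhedral
    obtain ⟨t, ht, ht'⟩ := (C.face F).polyhedral
    refine ⟨s.image (Q.proj (C.face F).linSpan), fun u hu => ?_, ?_⟩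
    · obtain ⟨v, hv, rfl⟩ := Finset.mem_image.1 hu
      exact Q.proj_rational t ht _ ((C.face F).linSpan_eq t ht') (hs v hv)
    · rw [hs', Finset.coe_image]
      exact Submodule.map_span _ _
  salient := by
    intro x hx hx'
    obtain ⟨c, hc, rfl⟩ := PointedCone.mem_map.1 hx
    obtain ⟨c', hc', he⟩ := PointedCone.mem_map.1 hx'
    have h1 : c + c' ∈ (C.face F).linSpan := by
      rw [← Q.proj_eq_zero_iff, map_add, he, add_neg_cancel]
    have h2 : ∀ y ∈ (C.face F).linSpan, ∃ f ∈ F.1, ∃ f' ∈ F.1, y + f' = f := by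
      intro y hy
      induction hy using Submodule.span_induction with
      | mem y hy => exact ⟨y, hy, 0, F.1.zero_mem, add_zero y⟩
      | zero => exact ⟨0, F.1.zero_mem, 0, F.1.zero_mem, add_zero 0⟩
      | add a b _ _ ha hb =>
        obtain ⟨f, hf, f', hf', e⟩ := ha
        obtain ⟨g, hg, g', hg', e'⟩ := hb
        exact ⟨f + g, F.1.add_mem hf hg, f' + g', F.1.add_mem hf' hg', by rw [← e, ← e']; abel⟩
      | smul r a _ ha =>
        obtain ⟨f, hf, f', hf', e⟩ := ha
        rcases le_total 0 r with hr | hr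
        · exact ⟨r • f, PointedCone.smul_mem _ hr hf, r • f', PointedCone.smul_mem _ hr hf',
            by rw [← e, smul_add]⟩
        · refine ⟨(-r) • f', PointedCone.smul_mem _ (neg_nonneg.2 hr) hf',
            (-r) • f, PointedCone.smul_mem _ (neg_nonneg.2 hr) hf, ?_⟩
          rw [← e]; module
    obtain ⟨f, hf, f', hf', e⟩ := h2 _ h1
    have hcF : c ∈ F.1 := F.2.mem_of_smul_add_mem (a := (1 : ℝ)) hc
      (C.cone.add_mem hc' (F.2.le hf')) one_pos (by rw [one_smul, ← add_assoc, e]; exact hf)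
    exact (Q.proj_eq_zero_iff _ c).2 (Submodule.subset_span hcF)
  lattice_rational := by
    intro u hu
    obtain ⟨t, ht, ht'⟩ := (C.face F).polyhedral
    obtain ⟨v, hv, rfl⟩ := Submodule.mem_map.1 hu
    exact Q.proj_rational t ht _ ((C.face F).linSpan_eq t ht') (C.lattice_rational v hv)
  lattice_fg := C.lattice_fg.map _
  span_lattice := by
    have h := congrArg (Submodule.map (Q.proj (C.face F).linSpan)) C.span_lattice
    rw [Submodule.map_span, Submodule.map_span] at h
    exact h

end LatticeCone

/-! ### The space of lattice cones and its structure maps -/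

/-- `ℚ𝒞`: the vector space over `ℚ` spanned by the set of lattice cones. -/
abbrev ConeSpace : Type := LatticeCone →₀ ℚ

/-- The locality relation on `ℚ𝒞`, extended linearly from orthogonality of lattice cones. -/
def coneTop (Q : RatInnerProduct) : ConeSpace → ConeSpace → Prop :=
  freeTop (LatticeCone.Orth Q)

open Classical in
/-- The bilinear map on `ℚ𝒞` that is the Minkowski product on orthogonal pairs of lattice cones
(and zero on other pairs, which do not occur in related elements of `ℚ𝒞`). -/
def mulAux (Q : RatInnerProduct) : ConeSpace →ₗ[ℚ] ConeSpace →ₗ[ℚ] ConeSpace :=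
  Finsupp.linearCombination ℚ fun C => Finsupp.linearCombination ℚ fun D =>
    if h : LatticeCone.Orth Q C D then Finsupp.single (LatticeCone.mul Q C D h) 1 else 0

/-- The Minkowski product on related pairs of `ℚ𝒞`. -/
def coneMul (Q : RatInnerProduct) (x y : ConeSpace) (_ : coneTop Q x y) : ConeSpace :=
  mulAux Q x y

/-- The unit of `ℚ𝒞`: the trivial lattice cone. -/
def coneOne : ConeSpace := Finsupp.single LatticeCone.unit 1

/-- The transverse coproduct `Δ(C) = ∑_F t(C, F) ⊗ F`, the sum over all faces `F` of `C`. -/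
def coneComul (Q : RatInnerProduct) : ConeSpace →ₗ[ℚ] ConeSpace ⊗[ℚ] ConeSpace :=
  Finsupp.linearCombination ℚ fun C => ∑ F : C.Face,
    Finsupp.single (LatticeCone.transverse Q C F) (1 : ℚ) ⊗ₜ[ℚ] Finsupp.single (C.face F) (1 : ℚ)

open Classical in
/-- The counit: `1` on the trivial lattice cone and `0` on all other lattice cones. -/
def coneCounit : ConeSpace →ₗ[ℚ] ℚ :=
  Finsupp.linearCombination ℚ fun C => if C = LatticeCone.unit then 1 else 0

end

end LocalityCone

/-!
All identities reduce to bijections between faces. The faces of a face `G` of `C` are the faces of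
`C` below `G`, and the faces of the transverse cone `t(C, F)` are the projections of the faces of
`C` above `F`. Since projecting along `F` and then along the image of `G` is projecting along `G`,
both iterated coproducts of `C` are sums over the flags `F ≤ G`. The linear spans of orthogonal
cones are in direct sum, so the faces of `C + D` are the sums `F + G` of faces, and `Δ` is
multiplicative on orthogonal pairs.

For the antipode, extend the product by zero to all of `ℚ𝒞`; it is still associative, so the linear
endomorphisms of `ℚ𝒞` form a monoid under convolution. Solving for the term `F = 0` of the coproduct
gives, by recursion on the dimension, a left inverse of every endomorphism that fixes `1`. The left
inverse of the identity fixes `1` as well, hence is also a right inverse.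
-/

namespace LocalityCone

noncomputable section

/-! ### Orthogonal projections -/

namespace RatInnerProduct

variable (Q : RatInnerProduct) {W U : Submodule ℝ RInf}

lemma proj_mem_orthogonal (W : Submodule ℝ RInf) [FiniteDimensional ℝ W] (x : RInf) :
    Q.proj W x ∈ Q.form.orthogonal W :=
  Submodule.projection_apply_mem (Q.isCompl W) x

lemma proj_eq [FiniteDimensional ℝ W] {x y : RInf} (hy : y ∈ Q.form.orthogonal W)
    (hxy : x - y ∈ W) : Q.proj W x = y := by
  rw [← sub_add_cancel x y, map_add, (Q.proj_eq_zero_iff W _).2 hxy, zero_add]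
  exact Submodule.projection_apply_of_mem_left _ hy

lemma proj_eq_self [FiniteDimensional ℝ W] {x : RInf} (hx : x ∈ Q.form.orthogonal W) :
    Q.proj W x = x :=
  Submodule.projection_apply_of_mem_left _ hx

lemma proj_eq_proj_iff (W : Submodule ℝ RInf) [FiniteDimensional ℝ W] {x y : RInf} :
    Q.proj W x = Q.proj W y ↔ x - y ∈ W := by
  rw [← Q.proj_eq_zero_iff W, map_sub, sub_eq_zero]

lemma sub_proj_mem (W : Submodule ℝ RInf) [FiniteDimensional ℝ W] (x : RInf) :
    x - Q.proj W x ∈ W :=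
  (Q.proj_eq_proj_iff W).1 (Q.proj_eq_self (Q.proj_mem_orthogonal W x)).symm

lemma proj_mem [FiniteDimensional ℝ W] (h : W ≤ U) {x : RInf} (hx : x ∈ U) :
    Q.proj W x ∈ U := by
  rw [← sub_sub_cancel x (Q.proj W x)]
  exact U.sub_mem hx (h (Q.sub_proj_mem W x))

lemma map_proj_le_orthogonal (W U : Submodule ℝ RInf) [FiniteDimensional ℝ W] :
    U.map (Q.proj W) ≤ Q.form.orthogonal W :=
  Submodule.map_le_iff_le_comap.2 fun x _ => Q.proj_mem_orthogonal W x

lemma sup_map_proj [FiniteDimensional ℝ W] (h : W ≤ U) : W ⊔ U.map (Q.proj W) = U := by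
  refine le_antisymm (sup_le h ?_) fun x hx => ?_
  · rintro _ ⟨x, hx, rfl⟩
    exact Q.proj_mem h hx
  · rw [← sub_add_cancel x (Q.proj W x)]
    exact Submodule.add_mem_sup (Q.sub_proj_mem W x) (Submodule.mem_map_of_mem hx)

lemma ker_proj (W : Submodule ℝ RInf) [FiniteDimensional ℝ W] : (Q.proj W).ker = W :=
  Submodule.ext fun x => LinearMap.mem_ker.trans (Q.proj_eq_zero_iff W x)

lemma proj_bot [FiniteDimensional ℝ (⊥ : Submodule ℝ RInf)] : Q.proj ⊥ = LinearMap.id :=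
  LinearMap.ext fun _ => Q.proj_eq_self fun w hw => by simp [(Submodule.mem_bot ℝ).1 hw]

-- A propositional equality of subspaces cannot be rewritten inside `Q.proj`, because of the
-- finiteness instance.
lemma proj_congr [FiniteDimensional ℝ W] [FiniteDimensional ℝ U] (h : W = U) :
    Q.proj W = Q.proj U := by
  subst h; rfl

lemma proj_sup [FiniteDimensional ℝ W] [FiniteDimensional ℝ U] [FiniteDimensional ℝ ↥(W ⊔ U)]
    (hWU : U ≤ Q.form.orthogonal W) : Q.proj (W ⊔ U) = Q.proj U ∘ₗ Q.proj W := by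
  refine LinearMap.ext fun x => Q.proj_eq ?_ ?_
  · have hW : Q.proj U (Q.proj W x) ∈ Q.form.orthogonal W := by
      rw [← sub_sub_cancel (Q.proj W x) (Q.proj U (Q.proj W x))]
      exact Submodule.sub_mem _ (Q.proj_mem_orthogonal W x) (hWU (Q.sub_proj_mem U _))
    have hU := Q.proj_mem_orthogonal U (Q.proj W x)
    intro v hv
    obtain ⟨w, hw, u, hu, rfl⟩ := Submodule.mem_sup.1 hv
    exact (by simpa using congrArg₂ (· + ·) (hW w hw) (hU u hu))
  · rw [← sub_add_sub_cancel x (Q.proj W x)]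
    exact Submodule.add_mem_sup (Q.sub_proj_mem W x) (Q.sub_proj_mem U _)

lemma proj_sup_of_mem {V : Submodule ℝ RInf} [FiniteDimensional ℝ W]
    [FiniteDimensional ℝ ↥(W ⊔ U)] (hW : W ≤ V)
    (hU : V ≤ Q.form.orthogonal U) {x : RInf} (hx : x ∈ V) :
    Q.proj (W ⊔ U) x = Q.proj W x := by
  refine Q.proj_eq (fun _ hv => ?_) (Submodule.mem_sup_left (Q.sub_proj_mem W x))
  obtain ⟨w, hw, u, hu, rfl⟩ := Submodule.mem_sup.1 hv
  simpa using congrArg₂ (· + ·) (Q.proj_mem_orthogonal W x w hw) (hU (Q.proj_mem hW hx) u hu)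

end RatInnerProduct

/-! ### Faces of pointed cones -/

lemma eq_of_add_eq_add_of_disjoint {R M : Type*} [Ring R] [AddCommGroup M] [Module R M]
    {V W : Submodule R M} (h : Disjoint V W) {v v' w w' : M}
    (hv : v ∈ V) (hv' : v' ∈ V) (hw : w ∈ W) (hw' : w' ∈ W)
    (he : v + w = v' + w') :
    v = v' ∧ w = w' := by
  have hvw : v - v' = w' - w := by rw [sub_eq_sub_iff_add_eq_add, he, add_comm]
  have h0 : v - v' = 0 :=
    Submodule.disjoint_def.1 h _ (V.sub_mem hv hv') (hvw ▸ W.sub_mem hw' hw)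
  exact ⟨sub_eq_zero.1 h0, (sub_eq_zero.1 (hvw ▸ h0)).symm⟩

section PointedCone

variable {R M N : Type*} [Field R] [LinearOrder R] [IsStrictOrderedRing R]
  [AddCommGroup M] [Module R M] [AddCommGroup N] [Module R N] {C D F G : PointedCone R M}

lemma exists_sub_eq_of_mem_span_cone {x : M} (hx : x ∈ Submodule.span R (F : Set M)) :
    ∃ y ∈ F, ∃ z ∈ F, y - z = x := by
  induction hx using Submodule.span_induction with
  | mem x hx => exact ⟨x, hx, 0, F.zero_mem, sub_zero x⟩
  | zero => exact ⟨0, F.zero_mem, 0, F.zero_mem, sub_zero 0⟩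
  | add _ _ _ _ ih₁ ih₂ =>
    obtain ⟨y₁, hy₁, z₁, hz₁, rfl⟩ := ih₁
    obtain ⟨y₂, hy₂, z₂, hz₂, rfl⟩ := ih₂
    exact ⟨_, F.add_mem hy₁ hy₂, _, F.add_mem hz₁ hz₂, add_sub_add_comm _ _ _ _⟩
  | smul r _ _ ih =>
    obtain ⟨y, hy, z, hz, rfl⟩ := ih
    rcases le_total 0 r with hr | hr
    · exact ⟨_, F.smul_mem hr hy, _, F.smul_mem hr hz, (smul_sub r y z).symm⟩
    · exact ⟨_, F.smul_mem (neg_nonneg.2 hr) hz, _, F.smul_mem (neg_nonneg.2 hr) hy, by module⟩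

lemma span_map_cone (f : M →ₗ[R] N) (C : PointedCone R M) :
    Submodule.span R (C.map f : Set N) = (Submodule.span R (C : Set M)).map f := by
  rw [PointedCone.coe_map, Submodule.map_span]

lemma span_sup_cone (C D : PointedCone R M) :
    Submodule.span R ((C ⊔ D : PointedCone R M) : Set M) =
      Submodule.span R (C : Set M) ⊔ Submodule.span R (D : Set M) := by
  refine le_antisymm (Submodule.span_le.2 fun x hx => ?_)
    (sup_le (Submodule.span_mono fun x => Submodule.mem_sup_left)
      (Submodule.span_mono fun x => Submodule.mem_sup_right))
  obtain ⟨c, hc, d, hd, rfl⟩ := Submodule.mem_sup.1 hx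
  exact Submodule.add_mem_sup (Submodule.subset_span hc) (Submodule.subset_span hd)

lemma mem_face_of_sub_mem_span (hG : G.IsFaceOf C) (hFG : F ≤ G) {x y : M} (hx : x ∈ C)
    (hy : y ∈ G) (hxy : x - y ∈ Submodule.span R (F : Set M)) : x ∈ G := by
  obtain ⟨z, hz, w, hw, h⟩ := exists_sub_eq_of_mem_span_cone hxy
  refine hG.mem_of_add_mem_left hx (hG.le (hFG hw)) ?_
  rw [← sub_eq_sub_iff_add_eq_add.1 h]
  exact G.add_mem (hFG hz) hy

lemma isFaceOf_inf_of_le (hF : F.IsFaceOf C) (hDC : D ≤ C) : (F ⊓ D).IsFaceOf D := by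
  simpa only [inf_eq_right.2 hDC] using hF.inf (PointedCone.IsFaceOf.refl D)

section Map

variable {f : M →ₗ[R] N}

lemma isFaceOf_map_of_ker_le (hF : F.IsFaceOf C) (hf : f.ker ≤ Submodule.span R (G : Set M))
    (hGF : G ≤ F) : (F.map f).IsFaceOf (C.map f) := by
  refine .of_mem_of_add_mem_left (Submodule.map_mono hF.le) ?_
  rintro _ _ ⟨x, hx, rfl⟩ ⟨y, hy, rfl⟩ ⟨z, hz, h⟩
  refine ⟨x, hF.mem_of_add_mem_left hx hy ?_, rfl⟩
  refine mem_face_of_sub_mem_span hF hGF (C.add_mem hx hy) hz (hf ?_)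
  rw [LinearMap.mem_ker, map_sub, map_add, sub_eq_zero]
  exact h.symm

lemma comap_map_inf_of_ker_le (hF : F.IsFaceOf C) (hf : f.ker ≤ Submodule.span R (G : Set M))
    (hGF : G ≤ F) : (F.map f).comap f ⊓ C = F := by
  refine le_antisymm ?_ fun x hx => ⟨⟨x, hx, rfl⟩, hF.le hx⟩
  rintro x ⟨⟨y, hy, h⟩, hx⟩
  exact mem_face_of_sub_mem_span hF hGF hx hy (hf (by simpa [sub_eq_zero] using h.symm))

lemma isFaceOf_comap_inf {H : PointedCone R N} (hH : H.IsFaceOf (C.map f)) :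
    (H.comap f ⊓ C).IsFaceOf C :=
  isFaceOf_inf_of_le (hH.comap f) fun x hx => ⟨x, hx, rfl⟩

lemma map_comap_inf {H : PointedCone R N} (hH : H ≤ C.map f) : (H.comap f ⊓ C).map f = H := by
  refine le_antisymm ?_ fun x hx => ?_
  · rintro _ ⟨x, hx, rfl⟩
    exact hx.1
  · obtain ⟨y, hy, rfl⟩ := hH hx
    exact ⟨y, ⟨hx, hy⟩, rfl⟩

end Map

section Sup

variable (h : Disjoint (Submodule.span R (C : Set M)) (Submodule.span R (D : Set M)))

include h

lemma isFaceOf_sup (hF : F.IsFaceOf C) (hG : G.IsFaceOf D) : (F ⊔ G).IsFaceOf (C ⊔ D) := by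
  refine .of_mem_of_add_mem_left (sup_le_sup hF.le hG.le) fun hx hy hxy => ?_
  obtain ⟨c, hc, d, hd, rfl⟩ := Submodule.mem_sup.1 hx
  obtain ⟨c', hc', d', hd', rfl⟩ := Submodule.mem_sup.1 hy
  obtain ⟨f, hf, g, hg, he⟩ := Submodule.mem_sup.1 hxy
  rw [add_add_add_comm] at he
  obtain ⟨rfl, rfl⟩ := eq_of_add_eq_add_of_disjoint h (Submodule.subset_span (hF.le hf))
    (Submodule.subset_span (C.add_mem hc hc')) (Submodule.subset_span (hG.le hg))
    (Submodule.subset_span (D.add_mem hd hd')) he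
  exact Submodule.add_mem_sup (hF.mem_of_add_mem_left hc hc' hf) (hG.mem_of_add_mem_left hd hd' hg)

lemma sup_inf_of_disjoint_span (hF : F ≤ C) (hG : G ≤ D) : (F ⊔ G) ⊓ C = F := by
  refine le_antisymm ?_ (le_inf le_sup_left hF)
  rintro x ⟨hx, hxC⟩
  obtain ⟨f, hf, g, hg, rfl⟩ := Submodule.mem_sup.1 hx
  obtain ⟨hfg, -⟩ := eq_of_add_eq_add_of_disjoint h (Submodule.subset_span (hF hf))
    (Submodule.subset_span hxC) (Submodule.subset_span (hG hg)) (Submodule.zero_mem _)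
    (add_zero (f + g)).symm
  exact hfg ▸ hf

end Sup

lemma inf_sup_inf_of_isFaceOf_sup (hF : F.IsFaceOf (C ⊔ D)) : (F ⊓ C) ⊔ (F ⊓ D) = F := by
  refine le_antisymm (sup_le inf_le_left inf_le_left) fun x hx => ?_
  obtain ⟨c, hc, d, hd, rfl⟩ := Submodule.mem_sup.1 (hF.le hx)
  have hc' : c ∈ C ⊔ D := Submodule.mem_sup_left hc
  have hd' : d ∈ C ⊔ D := Submodule.mem_sup_right hd
  exact Submodule.add_mem_sup ⟨hF.mem_of_add_mem_left hc' hd' hx, hc⟩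
    ⟨hF.mem_of_add_mem_right hc' hd' hx, hd⟩

end PointedCone

/-! ### Lattice cones -/

namespace LatticeCone

variable {Q : RatInnerProduct} {C D E C' D' : LatticeCone}

lemma lattice_le_linSpan (C : LatticeCone) {u : RInf} (hu : u ∈ C.lattice) : u ∈ C.linSpan := by
  rw [linSpan, ← C.span_lattice]
  exact Submodule.subset_span hu

lemma cone_le_linSpan (C : LatticeCone) {u : RInf} (hu : u ∈ C.cone) : u ∈ C.linSpan :=
  Submodule.subset_span hu

lemma linSpan_unit : unit.linSpan = ⊥ := by
  simp [linSpan, unit]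

lemma linSpan_eq_bot_iff : C.linSpan = ⊥ ↔ C = unit := by
  refine ⟨fun h => LatticeCone.ext ?_ ?_, fun h => h ▸ linSpan_unit⟩
  · exact (Submodule.eq_bot_iff _).2 fun x hx => by simpa [h] using C.cone_le_linSpan hx
  · exact (Submodule.eq_bot_iff _).2 fun x hx => by simpa [h] using C.lattice_le_linSpan hx

lemma orth_iff_linSpan_le_orthogonal :
    Orth Q C D ↔ D.linSpan ≤ Q.form.orthogonal C.linSpan :=
  ⟨fun h _ hy _ hx => h.span hx hy,
    fun h _ hu _ hv => h (D.lattice_le_linSpan hv) _ (C.lattice_le_linSpan hu)⟩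

lemma Orth.symm (h : Orth Q C D) : Orth Q D C :=
  fun u hu v hv => by rw [Q.symm]; exact h v hv u hu

lemma orth_comm : Orth Q C D ↔ Orth Q D C :=
  ⟨Orth.symm, Orth.symm⟩

lemma Orth.mono (h : Orth Q C D) (hC : C'.linSpan ≤ C.linSpan) (hD : D'.linSpan ≤ D.linSpan) :
    Orth Q C' D' :=
  orth_iff_linSpan_le_orthogonal.2 fun _ hy _ hx => h.span (hC hx) (hD hy)

lemma Orth.disjoint (h : Orth Q C D) : Disjoint C.linSpan D.linSpan :=
  (Q.isCompl C.linSpan).disjoint.symm.mono_right (orth_iff_linSpan_le_orthogonal.1 h)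

lemma orth_unit_left (Q : RatInnerProduct) (C : LatticeCone) : Orth Q unit C := fun u hu v _ => by
  rw [(Submodule.mem_bot ℤ).1 hu, map_zero, LinearMap.zero_apply]

lemma orth_unit_right (Q : RatInnerProduct) (C : LatticeCone) : Orth Q C unit :=
  (orth_unit_left Q C).symm

/-! ### The Minkowski product -/

lemma linSpan_mul (h : Orth Q C D) : (mul Q C D h).linSpan = C.linSpan ⊔ D.linSpan :=
  span_sup_cone C.cone D.cone

lemma orth_mul_left (h : Orth Q C D) : Orth Q (mul Q C D h) E ↔ Orth Q C E ∧ Orth Q D E := by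
  refine ⟨fun H => ⟨fun u hu => H u (Submodule.mem_sup_left hu),
    fun u hu => H u (Submodule.mem_sup_right hu)⟩, fun ⟨hC, hD⟩ u hu v hv => ?_⟩
  obtain ⟨a, ha, b, hb, rfl⟩ := Submodule.mem_sup.1 hu
  rw [map_add, LinearMap.add_apply, hC a ha v hv, hD b hb v hv, add_zero]

lemma orth_mul_right (h : Orth Q C D) : Orth Q E (mul Q C D h) ↔ Orth Q E C ∧ Orth Q E D := by
  rw [orth_comm, orth_mul_left, orth_comm (C := C), orth_comm (C := D)]

protected lemma mul_comm (h : Orth Q C D) : mul Q C D h = mul Q D C h.symm :=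
  LatticeCone.ext (sup_comm _ _) (sup_comm _ _)

protected lemma mul_assoc (h : Orth Q C D) (h₁ : Orth Q (mul Q C D h) E) (h' : Orth Q D E)
    (h₂ : Orth Q C (mul Q D E h')) :
    mul Q (mul Q C D h) E h₁ = mul Q C (mul Q D E h') h₂ :=
  LatticeCone.ext (sup_assoc _ _ _) (sup_assoc _ _ _)

lemma mul_unit (h : Orth Q C unit) : mul Q C unit h = C :=
  LatticeCone.ext (sup_bot_eq _) (sup_bot_eq _)

lemma mul_eq_unit_iff (h : Orth Q C D) : mul Q C D h = unit ↔ C = unit ∧ D = unit := by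
  simp only [← linSpan_eq_bot_iff, linSpan_mul, sup_eq_bot_iff]

/-! ### Faces and transverse cones -/

instance (C : LatticeCone) : PartialOrder C.Face :=
  inferInstanceAs (PartialOrder {F : PointedCone ℝ RInf // F.IsFaceOf C.cone})

instance (C : LatticeCone) : BoundedOrder C.Face where
  top := ⟨C.cone, .refl _⟩
  le_top F := F.2.le
  bot := ⟨⊥, .of_mem_of_add_mem_left bot_le fun {x _} hx hy h =>
    C.salient x hx (neg_eq_of_add_eq_zero_right h ▸ hy)⟩
  bot_le _ := bot_le (α := PointedCone ℝ RInf)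

variable {F G : C.Face}

lemma linSpan_face_mono (h : F ≤ G) : (C.face F).linSpan ≤ (C.face G).linSpan :=
  Submodule.span_mono h

lemma linSpan_face_le (C : LatticeCone) (F : C.Face) : (C.face F).linSpan ≤ C.linSpan :=
  Submodule.span_mono F.2.le

lemma face_top (C : LatticeCone) : C.face ⊤ = C :=
  LatticeCone.ext rfl (inf_eq_left.2 fun _ hu => C.lattice_le_linSpan hu)

lemma face_eq_unit_iff : C.face F = unit ↔ F = ⊥ :=
  ⟨fun h => Subtype.ext (congrArg cone h),
    fun h => linSpan_eq_bot_iff.1 (h ▸ linSpan_unit)⟩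

lemma face_bot (C : LatticeCone) : C.face ⊥ = unit :=
  face_eq_unit_iff.2 rfl

lemma linSpan_face_eq_iff : (C.face F).linSpan = C.linSpan ↔ F = ⊤ := by
  refine ⟨fun h => top_unique fun x hx => ?_, fun h => by rw [h, face_top]⟩
  refine mem_face_of_sub_mem_span F.2 le_rfl hx F.1.zero_mem ?_
  rw [sub_zero]
  exact h.ge (C.cone_le_linSpan hx)

lemma linSpan_transverse (Q : RatInnerProduct) (C : LatticeCone) (F : C.Face) :
    (transverse Q C F).linSpan = C.linSpan.map (Q.proj (C.face F).linSpan) :=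
  span_map_cone _ _

lemma linSpan_transverse_le (Q : RatInnerProduct) (C : LatticeCone) (F : C.Face) :
    (transverse Q C F).linSpan ≤ C.linSpan := by
  rw [linSpan_transverse]
  exact le_sup_right.trans_eq (Q.sup_map_proj (C.linSpan_face_le F))

lemma orth_face_transverse (Q : RatInnerProduct) (C : LatticeCone) (F : C.Face) :
    Orth Q (C.face F) (transverse Q C F) := by
  rw [orth_iff_linSpan_le_orthogonal, linSpan_transverse]
  exact Q.map_proj_le_orthogonal _ _

lemma transverse_eq_unit_iff : transverse Q C F = unit ↔ F = ⊤ := by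
  rw [← linSpan_eq_bot_iff, linSpan_transverse, ← LinearMap.le_ker_iff_map, Q.ker_proj,
    ← linSpan_face_eq_iff]
  exact ⟨(C.linSpan_face_le F).antisymm, fun h => h.ge⟩

lemma transverse_bot (Q : RatInnerProduct) (C : LatticeCone) : transverse Q C ⊥ = C := by
  have h : Q.proj (C.face ⊥).linSpan = LinearMap.id := by
    rw [Q.proj_congr (U := ⊥) (by rw [face_bot, linSpan_unit]), Q.proj_bot]
  exact LatticeCone.ext
    ((congrArg (PointedCone.map · C.cone) h).trans (PointedCone.map_id _))
    ((congrArg (fun f : RInf →ₗ[ℝ] RInf => C.lattice.map (f.restrictScalars ℤ)) h).trans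
      (Submodule.map_id _))

lemma finrank_transverse_lt (Q : RatInnerProduct) (hF : F ≠ ⊥) :
    Module.finrank ℝ (transverse Q C F).linSpan < Module.finrank ℝ C.linSpan := by
  refine Submodule.finrank_lt_finrank_of_lt
    (lt_of_le_of_ne (linSpan_transverse_le Q C F) fun h => hF ?_)
  rw [← face_eq_unit_iff, ← linSpan_eq_bot_iff]
  exact (orth_face_transverse Q C F).disjoint.eq_bot_of_le (h ▸ C.linSpan_face_le F)

/-! ### Faces of faces and of transverse cones -/

/-- The faces of a face `F` of `C` are the faces of `C` contained in `F`. -/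
def faceFaceEquiv (F : C.Face) : {G : C.Face // G ≤ F} ≃ (C.face F).Face where
  toFun G := ⟨G.1.1, (G.1.2.isFaceOf_iff_le F.2).2 G.2⟩
  invFun G := ⟨⟨G.1, G.2.trans F.2⟩, G.2.le⟩

lemma face_faceFaceEquiv (h : G ≤ F) :
    (C.face F).face (faceFaceEquiv F ⟨G, h⟩) = C.face G :=
  LatticeCone.ext rfl ((inf_assoc _ _ _).trans
    (congrArg (C.lattice ⊓ ·) (inf_eq_right.2 (linSpan_face_mono h))))

/-- The faces of the transverse cone `t(C, F)` are the projections of the faces of `C` that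
contain `F`. -/
def faceTransverseEquiv (Q : RatInnerProduct) (F : C.Face) :
    {G : C.Face // F ≤ G} ≃ (transverse Q C F).Face where
  toFun G := ⟨G.1.1.map (Q.proj (C.face F).linSpan),
    isFaceOf_map_of_ker_le G.1.2 (Q.ker_proj _).le G.2⟩
  invFun H := ⟨⟨H.1.comap (Q.proj (C.face F).linSpan) ⊓ C.cone, isFaceOf_comap_inf H.2⟩,
    fun x hx => ⟨by
      have h := (Q.proj_eq_zero_iff (C.face F).linSpan x).2 (Submodule.subset_span hx)
      exact PointedCone.mem_comap.2 (h ▸ H.1.zero_mem), F.2.le hx⟩⟩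
  left_inv G := Subtype.ext <| Subtype.ext <|
    comap_map_inf_of_ker_le G.1.2 (Q.ker_proj _).le G.2
  right_inv H := Subtype.ext (map_comap_inf H.2.le)

lemma linSpan_face_faceTransverseEquiv (Q : RatInnerProduct) (h : F ≤ G) :
    ((transverse Q C F).face (faceTransverseEquiv Q F ⟨G, h⟩)).linSpan =
      (C.face G).linSpan.map (Q.proj (C.face F).linSpan) :=
  span_map_cone _ _

lemma transverse_faceTransverseEquiv (Q : RatInnerProduct) (h : F ≤ G) :
    transverse Q (transverse Q C F) (faceTransverseEquiv Q F ⟨G, h⟩) = transverse Q C G := by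
  have hproj : Q.proj (C.face G).linSpan =
      Q.proj ((transverse Q C F).face (faceTransverseEquiv Q F ⟨G, h⟩)).linSpan ∘ₗ
        Q.proj (C.face F).linSpan := by
    rw [← Q.proj_sup]
    · refine Q.proj_congr ?_
      rw [linSpan_face_faceTransverseEquiv, Q.sup_map_proj (linSpan_face_mono h)]
    · rw [linSpan_face_faceTransverseEquiv]
      exact Q.map_proj_le_orthogonal _ _
  refine LatticeCone.ext ?_ ?_
  · exact (PointedCone.map_map _ _ _).trans (congrArg (PointedCone.map · C.cone) hproj.symm)
  · exact (Submodule.map_comp _ _ _).symm.trans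
      (congrArg (fun f : RInf →ₗ[ℝ] RInf => C.lattice.map (f.restrictScalars ℤ)) hproj.symm)

lemma face_faceTransverseEquiv (Q : RatInnerProduct) (h : F ≤ G) :
    (transverse Q C F).face (faceTransverseEquiv Q F ⟨G, h⟩) =
      transverse Q (C.face G) (faceFaceEquiv G ⟨F, h⟩) := by
  have hproj : Q.proj ((C.face G).face (faceFaceEquiv G ⟨F, h⟩)).linSpan =
      Q.proj (C.face F).linSpan := Q.proj_congr (by rw [face_faceFaceEquiv])
  have hmem : ∀ x, Q.proj (C.face F).linSpan x ∈
      ((transverse Q C F).face (faceTransverseEquiv Q F ⟨G, h⟩)).linSpan ↔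
        x ∈ (C.face G).linSpan := fun x => by
    rw [linSpan_face_faceTransverseEquiv, ← Submodule.mem_comap, Submodule.comap_map_eq_self]
    exact (Q.ker_proj _).trans_le (linSpan_face_mono h)
  refine LatticeCone.ext (congrArg (PointedCone.map · G.1) hproj.symm) (Eq.trans ?_
    (congrArg (fun f : RInf →ₗ[ℝ] RInf => (C.face G).lattice.map (f.restrictScalars ℤ))
      hproj.symm))
  ext y
  constructor
  · rintro ⟨⟨x, hx, rfl⟩, hxG⟩
    exact ⟨x, ⟨hx, (hmem x).1 hxG⟩, rfl⟩
  · rintro ⟨x, ⟨hx, hxG⟩, rfl⟩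
    exact ⟨⟨x, hx, rfl⟩, (hmem x).2 hxG⟩

/-! ### Faces of Minkowski products -/

/-- The faces of a product of orthogonal cones are the products of their faces. -/
def faceMulEquiv (h : Orth Q C D) : C.Face × D.Face ≃ (mul Q C D h).Face where
  toFun p := ⟨p.1.1 ⊔ p.2.1, isFaceOf_sup h.disjoint p.1.2 p.2.2⟩
  invFun H := (⟨H.1 ⊓ C.cone, isFaceOf_inf_of_le H.2 le_sup_left⟩,
    ⟨H.1 ⊓ D.cone, isFaceOf_inf_of_le H.2 le_sup_right⟩)
  left_inv p := Prod.ext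
    (Subtype.ext (sup_inf_of_disjoint_span h.disjoint p.1.2.le p.2.2.le))
    (Subtype.ext ((congrArg (· ⊓ D.cone) (sup_comm p.1.1 p.2.1)).trans
      (sup_inf_of_disjoint_span h.disjoint.symm p.2.2.le p.1.2.le)))
  right_inv H := Subtype.ext (inf_sup_inf_of_isFaceOf_sup H.2)

lemma orth_face (h : Orth Q C D) (F : C.Face) (G : D.Face) : Orth Q (C.face F) (D.face G) :=
  h.mono (C.linSpan_face_le F) (D.linSpan_face_le G)

lemma orth_transverse (h : Orth Q C D) (F : C.Face) (G : D.Face) :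
    Orth Q (transverse Q C F) (transverse Q D G) :=
  h.mono (linSpan_transverse_le Q C F) (linSpan_transverse_le Q D G)

lemma linSpan_face_faceMulEquiv (h : Orth Q C D) (F : C.Face) (G : D.Face) :
    ((mul Q C D h).face (faceMulEquiv h (F, G))).linSpan =
      (C.face F).linSpan ⊔ (D.face G).linSpan :=
  span_sup_cone F.1 G.1

lemma face_faceMulEquiv (h : Orth Q C D) (F : C.Face) (G : D.Face) :
    (mul Q C D h).face (faceMulEquiv h (F, G)) = mul Q (C.face F) (D.face G) (orth_face h F G) := by
  refine LatticeCone.ext rfl (le_antisymm ?_ ?_)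
  · rintro x ⟨hx, hxFG⟩
    obtain ⟨c, hc, d, hd, rfl⟩ := Submodule.mem_sup.1 hx
    obtain ⟨f, hf, g, hg, he⟩ := Submodule.mem_sup.1 ((linSpan_face_faceMulEquiv h F G).le hxFG)
    obtain ⟨rfl, rfl⟩ := eq_of_add_eq_add_of_disjoint h.disjoint (C.linSpan_face_le F hf)
      (C.lattice_le_linSpan hc) (D.linSpan_face_le G hg) (D.lattice_le_linSpan hd) he
    exact Submodule.add_mem_sup ⟨hc, hf⟩ ⟨hd, hg⟩
  · exact sup_le
      (inf_le_inf le_sup_left (Submodule.span_mono (le_sup_left (a := F.1) (b := G.1))))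
      (inf_le_inf le_sup_right (Submodule.span_mono (le_sup_right (a := F.1) (b := G.1))))

lemma proj_face_faceMulEquiv_left (h : Orth Q C D) (F : C.Face) (G : D.Face) {x : RInf}
    (hx : x ∈ C.linSpan) :
    Q.proj ((mul Q C D h).face (faceMulEquiv h (F, G))).linSpan x =
      Q.proj (C.face F).linSpan x := by
  rw [Q.proj_congr (linSpan_face_faceMulEquiv h F G)]
  exact Q.proj_sup_of_mem (C.linSpan_face_le F)
    (orth_iff_linSpan_le_orthogonal.1 (h.symm.mono (D.linSpan_face_le G) le_rfl)) hx

lemma proj_face_faceMulEquiv_right (h : Orth Q C D) (F : C.Face) (G : D.Face) {x : RInf}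
    (hx : x ∈ D.linSpan) :
    Q.proj ((mul Q C D h).face (faceMulEquiv h (F, G))).linSpan x =
      Q.proj (D.face G).linSpan x := by
  rw [Q.proj_congr ((linSpan_face_faceMulEquiv h F G).trans (sup_comm _ _))]
  exact Q.proj_sup_of_mem (D.linSpan_face_le G)
    (orth_iff_linSpan_le_orthogonal.1 (h.mono (C.linSpan_face_le F) le_rfl)) hx

lemma transverse_faceMulEquiv (h : Orth Q C D) (F : C.Face) (G : D.Face) :
    transverse Q (mul Q C D h) (faceMulEquiv h (F, G)) =
      mul Q (transverse Q C F) (transverse Q D G) (orth_transverse h F G) := by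
  refine LatticeCone.ext
    ((Submodule.map_sup _ _ _).trans (congrArg₂ (· ⊔ ·) ?_ ?_))
    ((Submodule.map_sup _ _ _).trans (congrArg₂ (· ⊔ ·) ?_ ?_)) <;>
    refine SetLike.coe_injective (Set.image_congr fun x hx => ?_)
  · exact proj_face_faceMulEquiv_left h F G (C.cone_le_linSpan hx)
  · exact proj_face_faceMulEquiv_right h F G (D.cone_le_linSpan hx)
  · exact proj_face_faceMulEquiv_left h F G (C.lattice_le_linSpan hx)
  · exact proj_face_faceMulEquiv_right h F G (D.lattice_le_linSpan hx)

end LatticeCone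

/-! ### Free locality spaces -/

section FreeLocality

variable {K X V : Type*} [Field K] [AddCommGroup V] [Module K V] {r : X → X → Prop}
  {x y : X →₀ K}

lemma map_mem_of_single_mem {L : (X →₀ K) →ₗ[K] V} {W : Submodule K V}
    (h : ∀ c ∈ x.support, L (Finsupp.single c 1) ∈ W) : L x ∈ W := by
  rw [← Finsupp.sum_single x, map_finsuppSum]
  refine Submodule.sum_mem _ fun c hc => ?_
  change L (Finsupp.single c (x c)) ∈ W
  rw [← Finsupp.smul_single_one, map_smul]
  exact W.smul_mem _ (h c hc)

lemma freeTop_iff_mem_supported :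
    freeTop r x y ↔ y ∈ Finsupp.supported K K {d | ∀ c ∈ x.support, r c d} :=
  ⟨fun h d hd c hc => h c hc d hd, fun h c hc _ hd => h hd c hc⟩

lemma freeTop_single_right {d : X} (h : ∀ c ∈ x.support, r c d) (b : K) :
    freeTop r x (Finsupp.single d b) :=
  freeTop_iff_mem_supported.2 (Finsupp.single_mem_supported K b h)

lemma freeTop_single {c d : X} (h : r c d) (a b : K) :
    freeTop r (Finsupp.single c a) (Finsupp.single d b) :=
  freeTop_single_right (fun _ hc => Finset.mem_singleton.1 (Finsupp.support_single_subset hc) ▸ h) b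

lemma freeTop_symm (hr : ∀ c d, r c d → r d c) (h : freeTop r x y) : freeTop r y x :=
  fun d hd c hc => hr c d (h c hc d hd)

lemma freeTop_map {L : (X →₀ K) →ₗ[K] X →₀ K}
    (h : ∀ d ∈ y.support, freeTop r x (L (Finsupp.single d 1))) : freeTop r x (L y) :=
  freeTop_iff_mem_supported.2 <| map_mem_of_single_mem fun d hd =>
    freeTop_iff_mem_supported.1 (h d hd)

variable (K) in
lemma isLocalityVectorSpace_freeTop (hr : ∀ c d, r c d → r d c) :
    IsLocalityVectorSpace K (freeTop (K := K) r) where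
  symm _ _ := freeTop_symm hr
  polar_subspace U := by
    refine ⟨⨅ u ∈ U, Finsupp.supported K K {d | ∀ c ∈ u.support, r c d}, Set.ext fun x => ?_⟩
    simp only [SetLike.mem_coe, Submodule.mem_iInf, ← freeTop_iff_mem_supported]
    rfl

lemma bilin_eq_of_freeTop {f g : (X →₀ K) →ₗ[K] (X →₀ K) →ₗ[K] V}
    (h : ∀ c d, r c d → f (Finsupp.single c 1) (Finsupp.single d 1) =
      g (Finsupp.single c 1) (Finsupp.single d 1)) (hxy : freeTop r x y) : f x y = g x y := by
  suffices (f - g).flip y x ∈ (⊥ : Submodule K V) from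
    sub_eq_zero.1 ((Submodule.mem_bot K).1 this)
  refine map_mem_of_single_mem fun c hc => ?_
  refine map_mem_of_single_mem (L := (f - g) (Finsupp.single c 1)) fun d hd => ?_
  exact (Submodule.mem_bot K).2 (sub_eq_zero.2 (h c d (hxy c hc d hd)))

end FreeLocality

lemma tensorTop_sum {K B ι κ : Type*} [Field K] [AddCommGroup B] [Module K B] [Fintype ι]
    [Fintype κ] {top : B → B → Prop} {a b : ι → B} {c d : κ → B} (hab : ∀ i, top (a i) (b i))
    (hcd : ∀ j, top (c j) (d j))
    (h : ∀ i j, top (a i) (c j) ∧ top (a i) (d j) ∧ top (b i) (c j) ∧ top (b i) (d j)) :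
    tensorTop K top (∑ i, a i ⊗ₜ[K] b i) (∑ j, c j ⊗ₜ[K] d j) :=
  let e := (Fintype.equivFin ι).symm
  let e' := (Fintype.equivFin κ).symm
  ⟨_, _, a ∘ e, b ∘ e, c ∘ e', d ∘ e', ⟨fun _ => hab _, fun _ => hcd _, fun _ _ => h _ _⟩,
    (e.sum_comp fun i => a i ⊗ₜ[K] b i).symm, (e'.sum_comp fun j => c j ⊗ₜ[K] d j).symm⟩

open LatticeCone

section Bialgebra

variable {Q : RatInnerProduct} {C D : LatticeCone} {u x y : ConeSpace}

/-! ### The algebra of lattice cones -/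

lemma mulAux_single_of_orth (h : Orth Q C D) :
    mulAux Q (Finsupp.single C 1) (Finsupp.single D 1) =
      Finsupp.single (LatticeCone.mul Q C D h) 1 := by
  simp [mulAux, h]

lemma mulAux_single_of_not_orth (h : ¬ Orth Q C D) :
    mulAux Q (Finsupp.single C 1) (Finsupp.single D 1) = 0 := by
  simp [mulAux, h]

lemma mulAux_comm (Q : RatInnerProduct) (x y : ConeSpace) : mulAux Q x y = mulAux Q y x := by
  suffices mulAux Q = (mulAux Q).flip from LinearMap.congr_fun₂ this x y
  ext C D : 4
  by_cases h : Orth Q C D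
  · simp [mulAux_single_of_orth, h, h.symm, LatticeCone.mul_comm h]
  · simp [mulAux_single_of_not_orth, h, mt Orth.symm h]

/-- Associativity holds on all of `ℚ𝒞`: both products vanish on lattice cones that are not
pairwise orthogonal. -/
lemma mulAux_assoc (Q : RatInnerProduct) (x y z : ConeSpace) :
    mulAux Q (mulAux Q x y) z = mulAux Q x (mulAux Q y z) := by
  suffices (mulAux Q).compr₂ (mulAux Q) =
      ((LinearMap.llcomp ℚ ConeSpace ConeSpace ConeSpace) ∘ₗ mulAux Q).compl₂ (mulAux Q) from
    LinearMap.congr_fun (LinearMap.congr_fun₂ this x y) z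
  ext C D E : 6
  by_cases hCD : Orth Q C D <;> by_cases hCE : Orth Q C E <;> by_cases hDE : Orth Q D E <;>
    simp [mulAux_single_of_orth, mulAux_single_of_not_orth, orth_mul_left, orth_mul_right, hCD,
      hCE, hDE, LatticeCone.mul_assoc]

lemma mulAux_one (Q : RatInnerProduct) (x : ConeSpace) : mulAux Q x coneOne = x := by
  suffices (mulAux Q).flip coneOne = LinearMap.id from LinearMap.congr_fun this x
  ext C : 2
  simp [coneOne, mulAux_single_of_orth (orth_unit_right Q C), mul_unit]

lemma one_mulAux (Q : RatInnerProduct) (x : ConeSpace) : mulAux Q coneOne x = x := by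
  rw [mulAux_comm, mulAux_one]

lemma coneTop_symm (h : coneTop Q x y) : coneTop Q y x :=
  freeTop_symm (fun _ _ => Orth.symm) h

lemma coneTop_mulAux (hx : coneTop Q u x) (hy : coneTop Q u y) : coneTop Q u (mulAux Q x y) := by
  refine freeTop_map fun D hD => ?_
  refine freeTop_map (L := (mulAux Q).flip (Finsupp.single D 1)) fun C hC => ?_
  rw [LinearMap.flip_apply]
  by_cases h : Orth Q C D
  · rw [mulAux_single_of_orth h]
    exact freeTop_single_right
      (fun E hE => (orth_mul_right h).2 ⟨hx E hE C hC, hy E hE D hD⟩) 1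
  · simp [mulAux_single_of_not_orth h, freeTop]

lemma isLocalityVectorSpace (Q : RatInnerProduct) : IsLocalityVectorSpace ℚ (coneTop Q) :=
  isLocalityVectorSpace_freeTop ℚ fun _ _ => Orth.symm

lemma isLocalityAlgebra (Q : RatInnerProduct) :
    IsLocalityAlgebra ℚ (coneTop Q) (coneMul Q) coneOne where
  vectorSpace := isLocalityVectorSpace Q
  bilinear :=
    { add_left := by simp [coneMul]
      add_right := by simp [coneMul]
      smul_left := by simp [coneMul]
      smul_right := by simp [coneMul] }
  monoid :=
    { symm := fun _ _ => coneTop_symm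
      mul_mem_polar := fun _ _ _ _ hx hy u hu => coneTop_mulAux (hx u hu) (hy u hu)
      assoc := fun x y z _ _ _ _ _ => mulAux_assoc Q x y z
      polar_one := Set.eq_univ_of_forall fun x u hu => hu ▸
        coneTop_symm (freeTop_single_right (fun D _ => orth_unit_right Q D) 1)
      mul_one := fun x _ => mulAux_one Q x
      one_mul := fun x _ => one_mulAux Q x }
  comm x y _ _ := mulAux_comm Q x y

/-! ### The coalgebra of lattice cones -/

lemma coneComul_single (Q : RatInnerProduct) (C : LatticeCone) :
    coneComul Q (Finsupp.single C 1) = ∑ F : C.Face,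
      Finsupp.single (transverse Q C F) 1 ⊗ₜ[ℚ] Finsupp.single (C.face F) 1 := by
  simp [coneComul]

open Classical in
lemma coneCounit_single (C : LatticeCone) :
    coneCounit (Finsupp.single C 1) = if C = unit then 1 else 0 := by
  simp [coneCounit]

lemma sum_subtype_comm {ι κ M : Type*} [Fintype ι] [Fintype κ] [AddCommMonoid M]
    (r : ι → κ → Prop) [∀ i, Fintype {j // r i j}] [∀ j, Fintype {i // r i j}]
    (f : ∀ i j, r i j → M) :
    ∑ i, ∑ j : {j // r i j}, f i j j.2 = ∑ j, ∑ i : {i // r i j}, f i j i.2 := by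
  rw [← Fintype.sum_sigma', ← Fintype.sum_sigma']
  exact Fintype.sum_equiv
    ⟨fun p => ⟨p.2.1, ⟨p.1, p.2.2⟩⟩, fun p => ⟨p.2.1, ⟨p.1, p.2.2⟩⟩,
      fun _ => rfl, fun _ => rfl⟩ _ _ fun _ => rfl

/-- Both iterated coproducts of `C` are the sum of `t(C, G) ⊗ t(G, F) ⊗ F` over the flags of faces
`F ≤ G`. -/
lemma coneComul_coassoc (Q : RatInnerProduct) :
    TensorProduct.assoc ℚ ConeSpace ConeSpace ConeSpace ∘ₗ
      (coneComul Q).rTensor ConeSpace ∘ₗ coneComul Q =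
      (coneComul Q).lTensor ConeSpace ∘ₗ coneComul Q := by
  classical
  ext C : 2
  let flagTerm (F G : C.Face) (h : F ≤ G) : ConeSpace ⊗[ℚ] (ConeSpace ⊗[ℚ] ConeSpace) :=
    Finsupp.single (transverse Q C G) 1 ⊗ₜ
      (Finsupp.single (transverse Q (C.face G) (faceFaceEquiv G ⟨F, h⟩)) 1 ⊗ₜ
        Finsupp.single (C.face F) 1)
  calc
    _ = ∑ F : C.Face, ∑ G : {G // F ≤ G}, flagTerm F G G.2 := by
      simp only [LinearMap.comp_apply, Finsupp.lsingle_apply, coneComul_single, map_sum,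
        LinearMap.rTensor_tmul, TensorProduct.sum_tmul, LinearEquiv.coe_coe,
        TensorProduct.assoc_tmul]
      exact Finset.sum_congr rfl fun F _ => .symm <|
        Fintype.sum_equiv (faceTransverseEquiv Q F) _ _ fun ⟨G, h⟩ => by
          rw [transverse_faceTransverseEquiv, face_faceTransverseEquiv]
    _ = ∑ G : C.Face, ∑ F : {F // F ≤ G}, flagTerm F G F.2 := sum_subtype_comm _ _
    _ = _ := by
      simp only [LinearMap.comp_apply, Finsupp.lsingle_apply, coneComul_single, map_sum,
        LinearMap.lTensor_tmul, TensorProduct.tmul_sum]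
      exact Finset.sum_congr rfl fun G _ =>
        Fintype.sum_equiv (faceFaceEquiv G) _ _ fun ⟨F, h⟩ => by rw [face_faceFaceEquiv]

lemma coneCounit_rTensor (Q : RatInnerProduct) :
    TensorProduct.lid ℚ ConeSpace ∘ₗ coneCounit.rTensor ConeSpace ∘ₗ coneComul Q =
      LinearMap.id := by
  classical
  ext C : 2
  simp [coneComul_single, coneCounit_single, transverse_eq_unit_iff, face_top]

lemma coneCounit_lTensor (Q : RatInnerProduct) :
    TensorProduct.rid ℚ ConeSpace ∘ₗ coneCounit.lTensor ConeSpace ∘ₗ coneComul Q =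
      LinearMap.id := by
  classical
  ext C : 2
  simp [coneComul_single, coneCounit_single, face_eq_unit_iff, transverse_bot]

lemma isLocalityCoalgebra (Q : RatInnerProduct) :
    IsLocalityCoalgebra ℚ (coneTop Q) (coneComul Q) coneCounit where
  vectorSpace := isLocalityVectorSpace Q
  comul_mem U x hx := map_mem_of_single_mem fun C hC => by
    rw [coneComul_single]
    refine Submodule.sum_mem _ fun F _ => Submodule.subset_span ⟨_, fun u hu => ?_, _,
      fun u hu => ?_, freeTop_single (orth_face_transverse Q C F).symm 1 1, rfl⟩
    · exact freeTop_single_right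
        (fun D hD => (hx u hu D hD C hC).mono le_rfl (linSpan_transverse_le Q C F)) 1
    · exact freeTop_single_right
        (fun D hD => (hx u hu D hD C hC).mono le_rfl (C.linSpan_face_le F)) 1
  coassoc := LinearMap.congr_fun (coneComul_coassoc Q)
  counit_left := LinearMap.congr_fun (coneCounit_rTensor Q)
  counit_right := LinearMap.congr_fun (coneCounit_lTensor Q)

/-! ### Compatibility of product and coproduct -/

lemma coneComul_eq_sum (Q : RatInnerProduct) (x : ConeSpace) :
    coneComul Q x = ∑ p : Σ C : x.support, C.1.Face,
      Finsupp.single (transverse Q p.1.1 p.2) (x p.1.1) ⊗ₜ[ℚ]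
        Finsupp.single (p.1.1.face p.2) 1 := by
  rw [Fintype.sum_sigma, coneComul, Finsupp.linearCombination_apply, Finsupp.sum,
    ← Finset.sum_coe_sort x.support]
  simp only [Finset.smul_sum, TensorProduct.smul_tmul', Finsupp.smul_single_one]

lemma tensorTop_coneComul (h : coneTop Q x y) :
    tensorTop ℚ (coneTop Q) (coneComul Q x) (coneComul Q y) := by
  rw [coneComul_eq_sum, coneComul_eq_sum]
  refine tensorTop_sum (fun p => freeTop_single (orth_face_transverse Q _ _).symm _ _)
    (fun p => freeTop_single (orth_face_transverse Q _ _).symm _ _) fun ⟨C, F⟩ ⟨D, G⟩ => ?_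
  have hCD : Orth Q C.1 D.1 := h _ C.2 _ D.2
  exact ⟨freeTop_single (orth_transverse hCD F G) _ _,
    freeTop_single (hCD.mono (linSpan_transverse_le Q _ F) (linSpan_face_le _ G)) _ _,
    freeTop_single (hCD.mono (linSpan_face_le _ F) (linSpan_transverse_le Q _ G)) _ _,
    freeTop_single (orth_face hCD F G) _ _⟩

lemma coneComul_mulAux (h : coneTop Q x y) :
    coneComul Q (mulAux Q x y) =
      TensorProduct.map₂ (mulAux Q) (mulAux Q) (coneComul Q x) (coneComul Q y) := by
  rw [← LinearMap.compr₂_apply, ← LinearMap.compl₁₂_apply]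
  refine bilin_eq_of_freeTop (fun C D hCD => ?_) h
  simp only [LinearMap.compr₂_apply, LinearMap.compl₁₂_apply, mulAux_single_of_orth hCD,
    coneComul_single, map_sum, LinearMap.sum_apply, TensorProduct.map₂_apply_tmul]
  rw [← (faceMulEquiv hCD).sum_comp, Fintype.sum_prod_type, Finset.sum_comm]
  simp only [face_faceMulEquiv, transverse_faceMulEquiv, TensorProduct.map_tmul,
    mulAux_single_of_orth (orth_transverse hCD _ _), mulAux_single_of_orth (orth_face hCD _ _)]

lemma coneCounit_mulAux (h : coneTop Q x y) :
    coneCounit (mulAux Q x y) = coneCounit x * coneCounit y := by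
  classical
  refine bilin_eq_of_freeTop (f := (mulAux Q).compr₂ coneCounit)
    (g := (LinearMap.mul ℚ ℚ).compl₁₂ coneCounit coneCounit) (fun C D hCD => ?_) h
  simp only [LinearMap.compr₂_apply, LinearMap.compl₁₂_apply, LinearMap.mul_apply',
    mulAux_single_of_orth hCD, coneCounit_single, mul_eq_unit_iff, ite_zero_mul_ite_zero, mul_one]

lemma coneCounit_one : coneCounit coneOne = 1 := by
  simp [coneOne, coneCounit_single]

lemma coneComul_one (Q : RatInnerProduct) : coneComul Q coneOne = coneOne ⊗ₜ[ℚ] coneOne := by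
  have hF (F : unit.Face) : F = ⊥ := bot_unique F.2.le
  rw [coneOne, coneComul_single, Fintype.sum_eq_single ⊥ fun F h => absurd (hF F) h,
    transverse_bot, face_bot]

lemma isLocalityBialgebra (Q : RatInnerProduct) :
    IsLocalityBialgebra ℚ (coneTop Q) (coneMul Q) coneOne (coneComul Q) coneCounit where
  algebra := isLocalityAlgebra Q
  coalgebra := isLocalityCoalgebra Q
  comul_top _ _ := tensorTop_coneComul
  comul_mul x y h m n a b c d H hx hy := by
    change coneComul Q (mulAux Q x y) = _
    rw [coneComul_mulAux h, hx, hy]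
    simp only [map_sum, LinearMap.sum_apply, TensorProduct.map₂_apply_tmul]
    exact Finset.sum_comm
  comul_one := coneComul_one Q
  counit_mul _ _ := coneCounit_mulAux
  counit_one := coneCounit_one

end Bialgebra

/-! ### The antipode -/

/-- The space `ℚ𝒞` as a `ℚ`-algebra and coalgebra, with the Minkowski product extended by zero to
pairs that are not orthogonal. The type synonym keeps these structures apart from the pointwise
product and the group-like coproduct that Mathlib puts on `LatticeCone →₀ ℚ`. It is a Hopf algebra
only in the locality sense: the coproduct is multiplicative on orthogonal pairs. -/
def ConeAlgebra (_ : RatInnerProduct) : Type := ConeSpace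

namespace ConeAlgebra

variable {Q : RatInnerProduct}

instance : AddCommGroup (ConeAlgebra Q) := inferInstanceAs (AddCommGroup ConeSpace)

instance : Module ℚ (ConeAlgebra Q) := inferInstanceAs (Module ℚ ConeSpace)

instance : CommRing (ConeAlgebra Q) where
  __ : AddCommGroup (ConeAlgebra Q) := inferInstance
  mul x y := mulAux Q x y
  one := coneOne
  left_distrib x := map_add (mulAux Q x)
  right_distrib := LinearMap.map_add₂ (mulAux Q)
  zero_mul := LinearMap.map_zero₂ (mulAux Q)
  mul_zero x := map_zero (mulAux Q x)
  mul_assoc := mulAux_assoc Q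
  one_mul := one_mulAux Q
  mul_one := mulAux_one Q
  mul_comm := mulAux_comm Q

instance : Algebra ℚ (ConeAlgebra Q) :=
  .ofModule (LinearMap.map_smul₂ (mulAux Q)) fun a x => map_smul (mulAux Q x) a

instance : Coalgebra ℚ (ConeAlgebra Q) where
  comul := coneComul Q
  counit := coneCounit
  coassoc := coneComul_coassoc Q
  rTensor_counit_comp_comul := (LinearEquiv.eq_toLinearMap_symm_comp _ _).2 (coneCounit_rTensor Q)
  lTensor_counit_comp_comul := (LinearEquiv.eq_toLinearMap_symm_comp _ _).2 (coneCounit_lTensor Q)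

variable (Q) in
/-- The basis of `ℚ𝒞` given by the lattice cones. -/
def of (C : LatticeCone) : ConeAlgebra Q := Finsupp.single C 1

lemma hom_ext {V : Type*} [AddCommGroup V] [Module ℚ V] {f g : ConeAlgebra Q →ₗ[ℚ] V}
    (h : ∀ C, f (of Q C) = g (of Q C)) : f = g :=
  Finsupp.lhom_ext' fun C => LinearMap.ext_ring (h C)

lemma one_eq_of : (1 : ConeAlgebra Q) = of Q unit := rfl

lemma comul_of (C : LatticeCone) : Coalgebra.comul (R := ℚ) (of Q C) =
    ∑ F : C.Face, of Q (transverse Q C F) ⊗ₜ[ℚ] of Q (C.face F) :=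
  coneComul_single Q C

lemma comul_one : Coalgebra.comul (R := ℚ) (1 : ConeAlgebra Q) = 1 ⊗ₜ 1 :=
  coneComul_one Q

lemma counit_one : Coalgebra.counit (R := ℚ) (1 : ConeAlgebra Q) = 1 :=
  coneCounit_one

lemma convMul_apply_of_comul_eq {ι : Type*} [Fintype ι]
    (f g : WithConv (ConeAlgebra Q →ₗ[ℚ] ConeAlgebra Q)) {x : ConeAlgebra Q}
    {a b : ι → ConeAlgebra Q} (h : Coalgebra.comul (R := ℚ) x = ∑ i, a i ⊗ₜ[ℚ] b i) :
    (f * g) x = ∑ i, f (a i) * g (b i) := by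
  simp [h]

lemma convMul_of (f g : WithConv (ConeAlgebra Q →ₗ[ℚ] ConeAlgebra Q)) (C : LatticeCone) :
    (f * g) (of Q C) = ∑ F : C.Face, f (of Q (transverse Q C F)) * g (of Q (C.face F)) :=
  convMul_apply_of_comul_eq f g (comul_of C)

lemma convMul_one (f g : WithConv (ConeAlgebra Q →ₗ[ℚ] ConeAlgebra Q)) :
    (f * g) 1 = f 1 * g 1 := by
  simp [comul_one]

open Classical in
/-- The value at a lattice cone of `leftConvInverse`: the equation `(h * g) C = ε(C) 1` solved for
the term `h(t(C, 0)) * g({0}) = h(C)` of its left side. -/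
def leftConvInverseOn (g : ConeAlgebra Q →ₗ[ℚ] ConeAlgebra Q) (C : LatticeCone) : ConeAlgebra Q :=
  algebraMap ℚ _ (Coalgebra.counit (of Q C)) - ∑ F : {F : C.Face // F ≠ ⊥},
    leftConvInverseOn g (transverse Q C F) * g (of Q (C.face F))
termination_by Module.finrank ℝ C.linSpan
decreasing_by exact finrank_transverse_lt Q F.2

/-- The left inverse for the convolution product of a linear map `g` with `g 1 = 1`. -/
def leftConvInverse (g : ConeAlgebra Q →ₗ[ℚ] ConeAlgebra Q) : ConeAlgebra Q →ₗ[ℚ] ConeAlgebra Q :=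
  Finsupp.linearCombination ℚ (leftConvInverseOn g)

lemma leftConvInverse_of (g : ConeAlgebra Q →ₗ[ℚ] ConeAlgebra Q) (C : LatticeCone) :
    leftConvInverse g (of Q C) = leftConvInverseOn g C :=
  (Finsupp.linearCombination_single ℚ 1 C).trans (one_smul ℚ _)

open WithConv (toConv)

variable {g : ConeAlgebra Q →ₗ[ℚ] ConeAlgebra Q}

lemma leftConvInverse_convMul (hg : g 1 = 1) : toConv (leftConvInverse g) * toConv g = 1 := by
  classical
  refine WithConv.ofConv_injective (hom_ext fun C => ?_)
  change (toConv (leftConvInverse g) * toConv g) (of Q C) = algebraMap ℚ _ _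
  rw [convMul_of, Fintype.sum_eq_add_sum_subtype_ne _ ⊥, transverse_bot, face_bot, ← one_eq_of]
  change leftConvInverse g (of Q C) * g 1 +
    ∑ F : {F : C.Face // F ≠ ⊥}, leftConvInverse g (of Q _) * g (of Q _) = _
  simp only [hg, mul_one, leftConvInverse_of]
  rw [leftConvInverseOn, sub_add_cancel]

lemma leftConvInverse_one (hg : g 1 = 1) : leftConvInverse g 1 = 1 := by
  have h := convMul_one (toConv (leftConvInverse g)) (toConv g)
  rw [leftConvInverse_convMul hg, LinearMap.convOne_apply, counit_one, map_one] at h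
  exact (h.trans ((congrArg _ hg).trans (mul_one _))).symm

lemma convMul_leftConvInverse (hg : g 1 = 1) : toConv g * toConv (leftConvInverse g) = 1 := by
  have h := leftConvInverse_convMul (leftConvInverse_one hg)
  rwa [left_inv_eq_right_inv h (leftConvInverse_convMul hg)] at h

lemma coneTop_leftConvInverseOn (hg : Independent (coneTop Q) (coneTop Q) id g)
    {x : ConeSpace} {C : LatticeCone} (hC : ∀ D ∈ x.support, Orth Q D C) :
    coneTop Q x (leftConvInverseOn g C) := by
  classical
  induction hn : Module.finrank ℝ C.linSpan using Nat.strong_induction_on generalizing C with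
  | _ n ih =>
  rw [leftConvInverseOn]
  refine freeTop_iff_mem_supported.2 <| Submodule.sub_mem _ ?_ <| Submodule.sum_mem _ fun F _ =>
    freeTop_iff_mem_supported.1 <| coneTop_mulAux ?_ ?_
  · exact Submodule.smul_mem _ _ <| freeTop_iff_mem_supported.1 <|
      freeTop_single_right (fun D _ => orth_unit_right Q D) 1
  · exact ih _ (hn ▸ finrank_transverse_lt Q F.2)
      (fun D hD => (hC D hD).mono le_rfl (linSpan_transverse_le Q C F)) rfl
  · exact hg x _ (freeTop_single_right
      (fun D hD => (hC D hD).mono le_rfl (C.linSpan_face_le F)) 1)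

lemma independent_leftConvInverse (hg : Independent (coneTop Q) (coneTop Q) id g) :
    Independent (coneTop Q) (coneTop Q) id (leftConvInverse g) := fun _ _ h =>
  freeTop_map (L := leftConvInverse g) fun C hC =>
    (leftConvInverse_of g C).symm ▸ coneTop_leftConvInverseOn hg fun D hD => h D hD C hC

lemma isConvolution_of_convMul_eq {f χ : ConeAlgebra Q →ₗ[ℚ] ConeAlgebra Q}
    (h : Independent (coneTop Q) (coneTop Q) f g) (hχ : toConv f * toConv g = toConv χ) :
    IsConvolution ℚ (coneTop Q) (coneMul Q) (coneComul Q) f g h χ := fun x _ _ _ _ hx =>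
  (convMul_apply_of_comul_eq (toConv f) (toConv g) hx).symm.trans
    (LinearMap.congr_fun (congrArg WithConv.ofConv hχ) x)

end ConeAlgebra

open ConeAlgebra

/-- The antipode of the locality Hopf algebra of lattice cones: the convolution inverse of the
identity. -/
def antipode (Q : RatInnerProduct) : ConeSpace →ₗ[ℚ] ConeSpace :=
  leftConvInverse (Q := Q) LinearMap.id

lemma isAntipode_antipode (Q : RatInnerProduct) :
    IsAntipode ℚ (coneTop Q) (coneMul Q) coneOne (coneComul Q) coneCounit (antipode Q) := by
  have h : Independent (coneTop Q) (coneTop Q) (LinearMap.id (R := ℚ)) (antipode Q) :=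
    independent_leftConvInverse fun _ _ => id
  have h' : Independent (coneTop Q) (coneTop Q) (antipode Q) (LinearMap.id (R := ℚ)) :=
    fun x y hxy => coneTop_symm (h y x (coneTop_symm hxy))
  exact ⟨h', h, isConvolution_of_convMul_eq h' (leftConvInverse_convMul rfl),
    isConvolution_of_convMul_eq h (convMul_leftConvInverse rfl)⟩

end

end LocalityCone

theorem corollary5p6 (Q : LocalityCone.RatInnerProduct) :
    LocalityCone.IsLocalityHopfAlgebra ℚ (LocalityCone.coneTop Q) (LocalityCone.coneMul Q)
      LocalityCone.coneOne (LocalityCone.coneComul Q) LocalityCone.coneCounit :=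
  ⟨LocalityCone.isLocalityBialgebra Q, LocalityCone.antipode Q,
    LocalityCone.isAntipode_antipode Q⟩
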